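/- Let $\mathcal H_2$ be the Siegel half space of symmetric $\tau=\begin{pmatrix}z_1&z_3\\z_3&z_2\end{pmatrix}\in M_2(\mathbb C)$ with $\operatorname{Im}\tau$ positive definite, and write $z_j=x_j+iy_j$. For $a,b\in\{0,1\}^2$ let $$\theta_{a,b}(\tau)=\sum_{m\in\mathbb Z^2}\exp\Bigl(i\pi\Bigl(\bigl(m+\tfrac a2\bigr)^t\tau\bigl(m+\tfrac a2\bigr)+2\bigl(m+\tfrac a2\bigr)^t\tfrac b2\Bigr)\Bigr),$$ and write $\theta_j=\theta_{(a_0,a_1),(b_0,b_1)}$ where $j=b_0+2b_1+4a_0+8a_1\in\{0,\dots,15\}$. The group $\mathrm{Sp}_4(\mathbb Z)$ acts on $\mathcal H_2$ by $\begin{pmatrix}A&B\\C&D\end{pmatrix}\tau=(A\tau+B)(C\tau+D)^{-1}$. Put $\gamma_0=I_4$ and, for $k=1,2,3$, $$\gamma_k=\begin{pmatrix}-I_2&-S_k\\S_k&-I_2+S_k^2\end{pmatrix}\in\mathrm{Sp}_4(\mathbb Z),\qquad S_1=\begin{pmatrix}1&0\\0&0\end{pmatrix},\ S_2=\begin{pmatrix}0&0\\0&1\end{pmatrix},\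 S_3=\begin{pmatrix}0&1\\1&0\end{pmatrix}.$$ Let $\mathcal F'$ be the set of all $\tau\in\mathcal H_2$ such that $|x_j|\le\frac12$ for $j=1,2,3$, $2|y_3|\le y_1\le y_2$, $y_1\ge\frac{\sqrt3}2$, and $|z_1|\ge1$, $|z_2|\ge1$. Let $\mathcal F_2$ be the usual fundamental domain for $\mathrm{Sp}_4(\mathbb Z)$, i.e. the set of all $\tau\in\mathcal H_2$ such that $|x_j|\le\frac12$ for $j=1,2,3$, $0\le2y_3\le y_1\le y_2$, and $|\det(C\tau+D)|\ge1$ for all $\begin{pmatrix}A&B\\C&D\end{pmatrix}\in\mathrm{Sp}_4(\mathbb Z)$. A set of complex numbers is in *good position* if it is contained in an open quarter plane, i.e. in the image of $\{z:\operatorname{Re}z>0,\ \operatorname{Im}z>0\}$ under a rotation about $0$. A sequence $(s_b^{(n)})_{b\in(\mathbb Z/2\mathbb Z)^2,\,n\ge0}$ of complex numbers is a *Borchardt sequence given by good sign choices* if for every $n\ge0$ there are square roots $t_b^{(n)}$ of $s_b^{(n)}$, $b\in(\mathbb Z/2\mathbb Z)^2$, which are in good position and satisfy $s_b^{(n+1)}=\frac14\sum_{b_1+b_2=b}t_{b_1}^{(n)}t_{b_2}^{(n)}$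 for every $b$. **Theorem.** We have $\mathcal F_2\subset\mathcal F'$. Let $\tau\in\mathcal F'$ and $0\le k\le3$. Then for every $n\ge0$ the theta constants $\theta_j(2^n\gamma_k\tau)$, $0\le j\le3$, are contained in a common open quarter plane. Consequently, $B(\gamma_k\tau)=\bigl(\theta_{0,b}^2(2^n\gamma_k\tau)\bigr)_{b\in\{0,1\}^2,\,n\ge0}$ is a Borchardt sequence given by good sign choices. -/

import Mathlib

open Matrix

noncomputable section

/-- The Siegel half space of genus `2`. -/
def SiegelH2 : Set (Matrix (Fin 2) (Fin 2) ℂ) :=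
  {τ | τ.IsSymm ∧ (τ.map Complex.im).PosDef}

/-- The theta constant `θ_{a,b}` of genus `2`, with characteristics `a, b ∈ {0,1}²`
(encoded as elements of `(ℤ/2ℤ)²`, represented by `0` and `1`). -/
def theta (a b : Fin 2 → ZMod 2) (τ : Matrix (Fin 2) (Fin 2) ℂ) : ℂ :=
  ∑' m : Fin 2 → ℤ,
    let v : Fin 2 → ℂ := fun i => (m i : ℂ) + ((a i).val : ℂ) / 2
    let w : Fin 2 → ℂ := fun i => ((b i).val : ℂ) / 2
    Complex.exp (Complex.I * Real.pi * (v ⬝ᵥ (τ *ᵥ v) + 2 * (v ⬝ᵥ w)))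

/-- The numbering `θ_j = θ_{(a₀,a₁),(b₀,b₁)}` for `j = b₀ + 2 b₁ + 4 a₀ + 8 a₁` in `{0,…,15}`;
the casts to `ZMod 2` extract the binary digits of `j`. -/
def thetaNum (j : ℕ) (τ : Matrix (Fin 2) (Fin 2) ℂ) : ℂ :=
  theta ![((j / 4 : ℕ) : ZMod 2), ((j / 8 : ℕ) : ZMod 2)]
    ![(j : ZMod 2), ((j / 2 : ℕ) : ZMod 2)] τ

/-- The integer blocks `A, B, C, D` of a symplectic matrix, as complex matrices. -/
def blockA (γ : symplecticGroup (Fin 2) ℤ) : Matrix (Fin 2) (Fin 2) ℂ :=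
  γ.1.toBlocks₁₁.map (fun x : ℤ => (x : ℂ))

def blockB (γ : symplecticGroup (Fin 2) ℤ) : Matrix (Fin 2) (Fin 2) ℂ :=
  γ.1.toBlocks₁₂.map (fun x : ℤ => (x : ℂ))

def blockC (γ : symplecticGroup (Fin 2) ℤ) : Matrix (Fin 2) (Fin 2) ℂ :=
  γ.1.toBlocks₂₁.map (fun x : ℤ => (x : ℂ))

def blockD (γ : symplecticGroup (Fin 2) ℤ) : Matrix (Fin 2) (Fin 2) ℂ :=
  γ.1.toBlocks₂₂.map (fun x : ℤ => (x : ℂ))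

/-- The action `γτ = (Aτ + B)(Cτ + D)⁻¹` of `Sp₄(ℤ)` on the Siegel half space. -/
def spAct (γ : symplecticGroup (Fin 2) ℤ) (τ : Matrix (Fin 2) (Fin 2) ℂ) :
    Matrix (Fin 2) (Fin 2) ℂ :=
  (blockA γ * τ + blockB γ) * (blockC γ * τ + blockD γ)⁻¹

/-- For symmetric `S`, the symplectic matrix with blocks `-1, -S, S, -1 + S²`. -/
def gammaOf (S : Matrix (Fin 2) (Fin 2) ℤ) (hS : Sᵀ = S) : symplecticGroup (Fin 2) ℤ :=
  ⟨fromBlocks (-1) (-S) S (-1 + S ^ 2), by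
    rw [SymplecticGroup.mem_iff]
    simp only [J, fromBlocks_transpose, fromBlocks_multiply, transpose_neg, transpose_add,
      transpose_one, transpose_pow, hS]
    congr 1 <;> noncomm_ring⟩

/-- The matrices `γ₀, γ₁, γ₂, γ₃` in `Sp₄(ℤ)`. -/
def gamma : Fin 4 → symplecticGroup (Fin 2) ℤ :=
  ![1,
    gammaOf !![1, 0; 0, 0] (by decide),
    gammaOf !![0, 0; 0, 1] (by decide),
    gammaOf !![0, 1; 1, 0] (by decide)]

/-- The domain `F'`. Here `τ 0 0 = z₁`, `τ 1 1 = z₂`, `τ 0 1 = z₃`. -/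
def FPrime : Set (Matrix (Fin 2) (Fin 2) ℂ) :=
  {τ | τ ∈ SiegelH2 ∧
    |(τ 0 0).re| ≤ 1 / 2 ∧ |(τ 1 1).re| ≤ 1 / 2 ∧ |(τ 0 1).re| ≤ 1 / 2 ∧
    2 * |(τ 0 1).im| ≤ (τ 0 0).im ∧ (τ 0 0).im ≤ (τ 1 1).im ∧
    Real.sqrt 3 / 2 ≤ (τ 0 0).im ∧
    1 ≤ ‖τ 0 0‖ ∧ 1 ≤ ‖τ 1 1‖}

/-- The usual fundamental domain for the action of `Sp₄(ℤ)` on the Siegel half space: real part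
bounded by `1/2`, imaginary part Minkowski-reduced, and `|det(Cτ + D)| ≥ 1` throughout
`Sp₄(ℤ)`. -/
def FTwo : Set (Matrix (Fin 2) (Fin 2) ℂ) :=
  {τ | τ ∈ SiegelH2 ∧
    |(τ 0 0).re| ≤ 1 / 2 ∧ |(τ 1 1).re| ≤ 1 / 2 ∧ |(τ 0 1).re| ≤ 1 / 2 ∧
    0 ≤ 2 * (τ 0 1).im ∧ 2 * (τ 0 1).im ≤ (τ 0 0).im ∧ (τ 0 0).im ≤ (τ 1 1).im ∧
    ∀ γ : symplecticGroup (Fin 2) ℤ, 1 ≤ ‖(blockC γ * τ + blockD γ).det‖}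

/-- A set of complex numbers is in good position if it lies in an open quarter plane, that is, in
the image of the open first quadrant under a rotation about the origin. -/
def InGoodPosition (s : Set ℂ) : Prop :=
  ∃ u : ℂ, u ≠ 0 ∧ ∀ z ∈ s, 0 < (u * z).re ∧ 0 < (u * z).im

/-- `s` is a Borchardt sequence, with `t` as the choice of square roots. -/
def IsBorchardtWith (s t : ℕ → (Fin 2 → ZMod 2) → ℂ) : Prop :=
  ∀ n, (∀ b, t n b ^ 2 = s n b) ∧
    ∀ b, s (n + 1) b =
      1 / 4 * ∑ p : (Fin 2 → ZMod 2) × (Fin 2 → ZMod 2) with p.1 + p.2 = b, t n p.1 * t n p.2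

/-- `s` is a Borchardt sequence given by good sign choices. -/
def IsGoodBorchardt (s : ℕ → (Fin 2 → ZMod 2) → ℂ) : Prop :=
  ∃ t, IsBorchardtWith s t ∧ ∀ n, InGoodPosition (Set.range (t n))

/-- The sequence `B(τ)` of the squares `θ_{0,b}(2ⁿτ)²`. -/
def borchardtSeq (τ : Matrix (Fin 2) (Fin 2) ℂ) : ℕ → (Fin 2 → ZMod 2) → ℂ :=
  fun n b => theta 0 b ((2 : ℂ) ^ n • τ) ^ 2

end

/-! By the duplication formula, the numbers θ_{0,b}(2τ)² arise from the θ_{0,b}(τ) by a Borchardt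
step. The theta constants at 2ⁿγ_kτ therefore serve as the square roots, and it remains to show that
they are in good position for every n. For a finite nonempty family this follows once any two
members s, t satisfy Re(s·conj t) > 0 (`PairwiseAcute.inGoodPosition`).

For n = 0, the transformation formula turns the θ_{0,b}(γ_kτ), up to one common factor, into theta
constants θ_{a,b}(τ) (`thetaCoord_partialInv`), and τ has a reduced imaginary part after a possible
change of sign of z₃. There the leading terms of the series dominate. Apart from θ_{(1,1),0}, all
constants that occur have argument in (-π/4, π/4). The constant θ_{(1,1),0}, which occurs for k = 3,
is compared with each of the others separately; the delicate case is
`re_theta₁₁_mul_conj_theta₀₀_pos`.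

The step from n to n+1 needs no estimates. If the family at level n lies in a quarter plane, a
rotation u puts the squares (u·s_b)² at level n+1 in the upper half plane, so each u·s_b lies in the
open first or third quadrant and no two of the s_b are orthogonal
(`re_mul_conj_ne_zero_of_borchardt`). Hence Re(s_b·conj s_c) has no zero on F'. It is continuous and
F' is connected, so its sign is constant. At τ = i·1 it is positive, since 2ⁿγ_kτ has imaginary part
2ⁿ·1 there and all θ_{0,b} are close to 1. -/

namespace SiegelTheta

open Complex ComplexConjugate

/-! ### Convergence and continuity of theta series -/

/-- The general term of the genus two theta constant with integral characteristics, in the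
coordinates `z₁ = τ₁₁`, `z₂ = τ₂₂`, `z₃ = τ₁₂`. -/
noncomputable def thetaTerm (a₁ a₂ b₁ b₂ : ℤ) (z₁ z₂ z₃ : ℂ) (m : ℤ × ℤ) : ℂ :=
  cexp (Real.pi * I * (z₁ * (m.1 + a₁ / 2) ^ 2 + 2 * z₃ * (m.1 + a₁ / 2) * (m.2 + a₂ / 2)
    + z₂ * (m.2 + a₂ / 2) ^ 2 + b₁ * (m.1 + a₁ / 2) + b₂ * (m.2 + a₂ / 2)))

/-- The genus two theta constant with integral characteristics, in coordinates. -/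
noncomputable def thetaCoord (a₁ a₂ b₁ b₂ : ℤ) (z₁ z₂ z₃ : ℂ) : ℂ :=
  ∑' m : ℤ × ℤ, thetaTerm a₁ a₂ b₁ b₂ z₁ z₂ z₃ m

/-- The imaginary part of the symmetric matrix with entries `z₁, z₂, z₃` is positive definite. -/
def IsSiegel (z₁ z₂ z₃ : ℂ) : Prop := 0 < z₁.im ∧ z₃.im ^ 2 < z₁.im * z₂.im

theorem IsSiegel.im_pos_right {z₁ z₂ z₃ : ℂ} (h : IsSiegel z₁ z₂ z₃) : 0 < z₂.im := by
  obtain ⟨h₁, h₂⟩ := h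
  nlinarith [sq_nonneg z₃.im, (mul_pos_iff_of_pos_left h₁).1 (lt_of_le_of_lt (sq_nonneg z₃.im) h₂)]

theorem IsSiegel.swap {z₁ z₂ z₃ : ℂ} (h : IsSiegel z₁ z₂ z₃) : IsSiegel z₂ z₁ z₃ :=
  ⟨h.im_pos_right, by rw [mul_comm]; exact h.2⟩

theorem norm_thetaTerm (a₁ a₂ b₁ b₂ : ℤ) (z₁ z₂ z₃ : ℂ) (m : ℤ × ℤ) :
    ‖thetaTerm a₁ a₂ b₁ b₂ z₁ z₂ z₃ m‖ =
      Real.exp (-Real.pi * (z₁.im * (m.1 + a₁ / 2) ^ 2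
        + 2 * z₃.im * (m.1 + a₁ / 2) * (m.2 + a₂ / 2) + z₂.im * (m.2 + a₂ / 2) ^ 2)) := by
  obtain ⟨v, hv⟩ : ∃ v : ℝ, v = m.1 + a₁ / 2 := ⟨_, rfl⟩
  obtain ⟨w, hw⟩ : ∃ w : ℝ, w = m.2 + a₂ / 2 := ⟨_, rfl⟩
  have hv' : (m.1 : ℂ) + a₁ / 2 = (v : ℂ) := by rw [hv]; push_cast; rfl
  have hw' : (m.2 : ℂ) + a₂ / 2 = (w : ℂ) := by rw [hw]; push_cast; rfl
  rw [thetaTerm, Complex.norm_exp, hv', hw', ← hv, ← hw]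
  congr 1
  simp [pow_two]

theorem hasSum_pow_natAbs {ρ : ℝ} (h₀ : 0 ≤ ρ) (h₁ : ρ < 1) :
    HasSum (fun n : ℤ => ρ ^ n.natAbs) ((1 + ρ) / (1 - ρ)) := by
  have hg := hasSum_geometric_of_lt_one h₀ h₁
  have h : HasSum (fun n : ℤ => ρ ^ n.natAbs) ((1 - ρ)⁻¹ + ρ * (1 - ρ)⁻¹) := by
    refine HasSum.of_nat_of_neg_add_one (by simpa using hg) ?_
    have hn : (fun n : ℕ => ρ ^ (-((n : ℤ) + 1)).natAbs) = fun n : ℕ => ρ * ρ ^ n := by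
      funext n
      have : (-((n : ℤ) + 1)).natAbs = n + 1 := by omega
      rw [this, pow_succ, mul_comm]
    rw [hn]
    exact hg.mul_left ρ
  convert h using 1
  field_simp

theorem hasSum_pow_natAbs_prod {ρ : ℝ} (h₀ : 0 ≤ ρ) (h₁ : ρ < 1) :
    HasSum (fun m : ℤ × ℤ => ρ ^ (m.1.natAbs + m.2.natAbs)) (((1 + ρ) / (1 - ρ)) ^ 2) := by
  have h := hasSum_pow_natAbs h₀ h₁
  have hs := h.summable.mul_of_nonneg h.summable (fun _ => by positivity) (fun _ => by positivity)
  simpa only [pow_add, pow_two] using h.mul h hs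

/-- Completing the square in |m|. A linear lower bound lets a geometric series in |m₁| + |m₂|
dominate the Gaussian. -/
theorem natAbs_sub_le_sq (a m : ℤ) : (m.natAbs : ℝ) - (|(a : ℝ)| + 1) ^ 2 / 4
    ≤ ((m : ℝ) + a / 2) ^ 2 := by
  have : (m.natAbs : ℝ) = |(m : ℝ)| := by simp [Nat.cast_natAbs]
  rw [this]
  have h1 : -(|(a : ℝ)| * |(m : ℝ)|) ≤ a * m := by
    rw [← abs_mul]; exact neg_abs_le _
  nlinarith [sq_nonneg (|(m : ℝ)| - (|(a : ℝ)| + 1) / 2), sq_abs (m : ℝ), sq_nonneg (a : ℝ)]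

theorem summable_gaussian (a₁ a₂ : ℤ) {ε : ℝ} (hε : 0 < ε) :
    Summable fun m : ℤ × ℤ =>
      Real.exp (-Real.pi * (ε * (((m.1 : ℝ) + a₁ / 2) ^ 2 + ((m.2 : ℝ) + a₂ / 2) ^ 2))) := by
  set K : ℝ := (|(a₁ : ℝ)| + 1) ^ 2 / 4 + (|(a₂ : ℝ)| + 1) ^ 2 / 4
  have hπε : 0 < Real.pi * ε := mul_pos Real.pi_pos hε
  have hs := ((hasSum_pow_natAbs_prod (ρ := Real.exp (-(Real.pi * ε))) (Real.exp_nonneg _)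
    (by rw [Real.exp_lt_one_iff]; linarith)).summable.mul_left (Real.exp (Real.pi * ε * K)))
  refine Summable.of_nonneg_of_le (fun _ => Real.exp_nonneg _) (fun m => ?_) hs
  rw [← Real.exp_nat_mul, ← Real.exp_add, Real.exp_le_exp]
  push_cast
  have := mul_le_mul_of_nonneg_left
    (add_le_add (natAbs_sub_le_sq a₁ m.1) (natAbs_sub_le_sq a₂ m.2)) hπε.le
  simp only [K]
  linarith

theorem quadraticForm_ge {y₁ y₂ y₃ ε : ℝ} (h₁ : ε < y₁) (h : y₃ ^ 2 < (y₁ - ε) * (y₂ - ε))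
    (v w : ℝ) : ε * (v ^ 2 + w ^ 2) ≤ y₁ * v ^ 2 + 2 * y₃ * v * w + y₂ * w ^ 2 := by
  have h₁' : 0 < y₁ - ε := sub_pos.2 h₁
  have : 0 ≤ (y₁ - ε) * ((y₁ - ε) * v ^ 2 + 2 * y₃ * v * w + (y₂ - ε) * w ^ 2) := by
    nlinarith [sq_nonneg ((y₁ - ε) * v + y₃ * w), mul_nonneg (sub_nonneg.2 h.le) (sq_nonneg w)]
  have := nonneg_of_mul_nonneg_right this h₁'
  linarith

/-- Positive definiteness is an open condition, so Im τ - ε·1 is still positive definite for small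
ε. This gives a Gaussian majorant that is uniform near the point, as continuity requires. -/
theorem IsSiegel.exists_pos {z₁ z₂ z₃ : ℂ} (h : IsSiegel z₁ z₂ z₃) :
    ∃ ε : ℝ, 0 < ε ∧ ε < z₁.im ∧ z₃.im ^ 2 < (z₁.im - ε) * (z₂.im - ε) := by
  have hc : ContinuousAt (fun ε : ℝ => (z₁.im - ε) * (z₂.im - ε)) 0 := by fun_prop
  have h1 := hc.eventually_const_lt (u := z₃.im ^ 2) (by simpa using h.2)
  have h2 := (h1.and (eventually_lt_nhds h.1)).filter_mono (nhdsWithin_le_nhds (s := Set.Ioi 0))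
  obtain ⟨ε, ⟨hε, hε'⟩, hpos⟩ := (h2.and self_mem_nhdsWithin).exists
  exact ⟨ε, hpos, hε', hε⟩

theorem norm_thetaTerm_le {z₁ z₂ z₃ : ℂ} {ε : ℝ} (h₁ : ε < z₁.im)
    (h : z₃.im ^ 2 < (z₁.im - ε) * (z₂.im - ε)) (a₁ a₂ b₁ b₂ : ℤ) (m : ℤ × ℤ) :
    ‖thetaTerm a₁ a₂ b₁ b₂ z₁ z₂ z₃ m‖ ≤
      Real.exp (-Real.pi * (ε * (((m.1 : ℝ) + a₁ / 2) ^ 2 + ((m.2 : ℝ) + a₂ / 2) ^ 2))) := by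
  rw [norm_thetaTerm, Real.exp_le_exp]
  have := quadraticForm_ge h₁ h ((m.1 : ℝ) + a₁ / 2) ((m.2 : ℝ) + a₂ / 2)
  nlinarith [Real.pi_pos]

theorem summable_norm_thetaTerm {z₁ z₂ z₃ : ℂ} (h : IsSiegel z₁ z₂ z₃) (a₁ a₂ b₁ b₂ : ℤ) :
    Summable fun m => ‖thetaTerm a₁ a₂ b₁ b₂ z₁ z₂ z₃ m‖ := by
  obtain ⟨ε, hε, h₁, h₂⟩ := h.exists_pos
  exact Summable.of_nonneg_of_le (fun _ => norm_nonneg _)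
    (norm_thetaTerm_le h₁ h₂ a₁ a₂ b₁ b₂) (summable_gaussian a₁ a₂ hε)

theorem continuousAt_thetaCoord (a₁ a₂ b₁ b₂ : ℤ) {z : ℂ × ℂ × ℂ}
    (h : IsSiegel z.1 z.2.1 z.2.2) :
    ContinuousAt (fun z : ℂ × ℂ × ℂ => thetaCoord a₁ a₂ b₁ b₂ z.1 z.2.1 z.2.2) z := by
  obtain ⟨ε, hε, h₁, h₂⟩ := h.exists_pos
  set s : Set (ℂ × ℂ × ℂ) :=
    {z | ε < z.1.im} ∩ {z | z.2.2.im ^ 2 < (z.1.im - ε) * (z.2.1.im - ε)}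
  have hs : IsOpen s :=
    (isOpen_lt (by fun_prop) (by fun_prop)).inter (isOpen_lt (by fun_prop) (by fun_prop))
  have : ContinuousOn (fun z : ℂ × ℂ × ℂ => thetaCoord a₁ a₂ b₁ b₂ z.1 z.2.1 z.2.2) s := by
    refine continuousOn_tsum (fun m => ?_) (summable_gaussian a₁ a₂ hε)
      (fun m w hw => norm_thetaTerm_le hw.1 hw.2 a₁ a₂ b₁ b₂ m)
    unfold thetaTerm
    fun_prop
  exact this.continuousAt (hs.mem_nhds ⟨h₁, h₂⟩)

/-! ### Symmetries, translations and partial inversion -/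

theorem thetaCoord_swap (a₁ a₂ b₁ b₂ : ℤ) (z₁ z₂ z₃ : ℂ) :
    thetaCoord a₂ a₁ b₂ b₁ z₂ z₁ z₃ = thetaCoord a₁ a₂ b₁ b₂ z₁ z₂ z₃ := by
  rw [thetaCoord, thetaCoord, ← (Equiv.prodComm ℤ ℤ).tsum_eq]
  refine tsum_congr fun m => ?_
  simp only [thetaTerm, Equiv.prodComm_apply, Prod.fst_swap, Prod.snd_swap]
  congr 2
  ring

theorem exp_pi_mul_I_mul_eq {x y : ℂ} (k : ℤ) (h : x = y + 2 * k) :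
    cexp (Real.pi * I * x) = cexp (Real.pi * I * y) := by
  rw [h, Complex.exp_eq_exp_iff_exists_int]
  exact ⟨k, by ring⟩

/-- The substitution m₂ ↦ -m₂ - a₂ negates m₂ + a₂/2. It changes the term by the sign (-1)^(a₂b₂),
which the hypothesis makes trivial. -/
theorem thetaCoord_neg (a₁ a₂ b₁ b₂ : ℤ) (h : a₂ * b₂ = 0) (z₁ z₂ z₃ : ℂ) :
    thetaCoord a₁ a₂ b₁ b₂ z₁ z₂ (-z₃) = thetaCoord a₁ a₂ b₁ b₂ z₁ z₂ z₃ := by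
  rw [thetaCoord, thetaCoord,
    ← ((Equiv.refl ℤ).prodCongr ((Equiv.neg ℤ).trans (Equiv.addRight (-a₂)))).tsum_eq]
  refine tsum_congr fun m => ?_
  have h' : (a₂ : ℂ) * b₂ = 0 := by exact_mod_cast h
  simp only [thetaTerm, Equiv.prodCongr_apply, Prod.map, Equiv.refl_apply, Equiv.trans_apply,
    Equiv.neg_apply, Equiv.coe_addRight]
  refine exp_pi_mul_I_mul_eq (-b₂ * m.2) ?_
  push_cast
  linear_combination -h'

/-- Translation of `z₁` by `-1`. -/
theorem thetaCoord_sub_one (a₂ b₁ b₂ : ℤ) (z₁ z₂ z₃ : ℂ) :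
    thetaCoord 0 a₂ b₁ b₂ (z₁ - 1) z₂ z₃ = thetaCoord 0 a₂ (1 - b₁) b₂ z₁ z₂ z₃ := by
  refine tsum_congr fun m => ?_
  -- The translation contributes exp(-πi·m₁²) = exp(πi·m₁), because m₁(m₁ + 1) is even.
  obtain ⟨k, hk⟩ := (Int.even_mul_succ_self m.1)
  have hk' : (m.1 : ℂ) * (m.1 + 1) = k + k := by exact_mod_cast hk
  refine exp_pi_mul_I_mul_eq (-k + b₁ * m.1) ?_
  push_cast
  linear_combination -hk'

/-- Translation of `z₃` by `-1`. -/
theorem thetaCoord_sub_one' (b₁ b₂ : ℤ) (z₁ z₂ z₃ : ℂ) :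
    thetaCoord 0 0 b₁ b₂ z₁ z₂ (z₃ - 1) = thetaCoord 0 0 b₁ b₂ z₁ z₂ z₃ := by
  refine tsum_congr fun m => exp_pi_mul_I_mul_eq (-m.1 * m.2) ?_
  push_cast
  ring

theorem im_neg_inv (z : ℂ) : (-1 / z).im = z.im / normSq z := by
  rw [neg_div, Complex.neg_im, one_div, Complex.inv_im]; ring

theorem IsSiegel.ne_zero {z₁ z₂ z₃ : ℂ} (h : IsSiegel z₁ z₂ z₃) : z₁ ≠ 0 := by
  rintro rfl
  exact lt_irrefl _ h.1

/-- The determinant of the imaginary part gets divided by |z₁|². -/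
theorem IsSiegel.partialInv {z₁ z₂ z₃ : ℂ} (h : IsSiegel z₁ z₂ z₃) :
    IsSiegel (-1 / z₁) (z₂ - z₃ ^ 2 / z₁) (-z₃ / z₁) := by
  have hN : 0 < normSq z₁ := normSq_pos.2 h.ne_zero
  refine ⟨by rw [im_neg_inv]; exact div_pos h.1 hN, ?_⟩
  have key : (-1 / z₁).im * (z₂ - z₃ ^ 2 / z₁).im - (-z₃ / z₁).im ^ 2
      = (z₁.im * z₂.im - z₃.im ^ 2) / normSq z₁ := by
    rw [im_neg_inv]
    have hN' : z₁.re ^ 2 + z₁.im ^ 2 ≠ 0 := by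
      rw [normSq_apply] at hN; nlinarith
    simp only [Complex.sub_im, Complex.div_im, Complex.neg_re, Complex.neg_im, pow_two,
      Complex.mul_re, Complex.mul_im, normSq_apply]
    simp only [← pow_two]
    field_simp
    ring
  have : 0 < (z₁.im * z₂.im - z₃.im ^ 2) / normSq z₁ := div_pos (sub_pos.2 h.2) hN
  linarith

/-- The transformation of theta constants under the partial inversion in the first variable. -/
theorem thetaCoord_partialInv (a₂ b₁ b₂ : ℤ) {z₁ z₂ z₃ : ℂ} (h : IsSiegel z₁ z₂ z₃) :
    thetaCoord 0 a₂ b₁ b₂ (-1 / z₁) (z₂ - z₃ ^ 2 / z₁) (-z₃ / z₁) =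
      1 / (-I * (-1 / z₁)) ^ (1 / 2 : ℂ) * thetaCoord b₁ a₂ 0 b₂ z₁ z₂ z₃ := by
  have hz := h.ne_zero
  -- The coordinates are exchanged so that m₁ is the inner summation index: for fixed m₂ the inner
  -- sum is a Jacobi theta function, to which the one-variable functional equation applies. Its
  -- factor does not depend on m₂.
  rw [thetaCoord, thetaCoord, ← (Equiv.prodComm ℤ ℤ).tsum_eq (thetaTerm 0 _ _ _ _ _ _),
    ← (Equiv.prodComm ℤ ℤ).tsum_eq (thetaTerm b₁ a₂ 0 b₂ z₁ z₂ z₃),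
    Summable.tsum_prod, Summable.tsum_prod, ← tsum_mul_left]
  rotate_left
  · exact (Equiv.prodComm ℤ ℤ).summable_iff.2 (summable_norm_thetaTerm h b₁ a₂ 0 b₂).of_norm
  · exact (Equiv.prodComm ℤ ℤ).summable_iff.2
      (summable_norm_thetaTerm h.partialInv 0 a₂ b₁ b₂).of_norm
  refine tsum_congr fun m₂ => ?_
  obtain ⟨v, hv⟩ : ∃ v : ℂ, v = m₂ + a₂ / 2 := ⟨_, rfl⟩
  set u : ℂ := -v * z₃ / z₁ + b₁ / 2 with hu
  have hL : ∀ m₁ : ℤ, thetaTerm 0 a₂ b₁ b₂ (-1 / z₁) (z₂ - z₃ ^ 2 / z₁) (-z₃ / z₁)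
      (Equiv.prodComm ℤ ℤ (m₂, m₁)) =
      cexp (Real.pi * I * ((z₂ - z₃ ^ 2 / z₁) * v ^ 2 + b₂ * v)) *
        jacobiTheta₂_term m₁ u (-1 / z₁) := by
    intro m₁
    simp only [thetaTerm, jacobiTheta₂_term, ← Complex.exp_add, Equiv.prodComm_apply,
      Prod.fst_swap, Prod.snd_swap, ← hv, hu]
    congr 1
    push_cast
    field_simp
    ring
  -- The shift by b₁ is needed because completing the square produces m₁ - b₁/2 = (m₁ - b₁) + b₁/2:
  -- the characteristic b₁ has moved to the upper place.
  have hR : ∀ m₁ : ℤ, thetaTerm b₁ a₂ 0 b₂ z₁ z₂ z₃ (Equiv.prodComm ℤ ℤ (m₂, m₁ - b₁)) =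
      cexp (Real.pi * I * ((z₂ - z₃ ^ 2 / z₁) * v ^ 2 + b₂ * v)) *
        (cexp (-Real.pi * I * u ^ 2 / (-1 / z₁)) *
          jacobiTheta₂_term m₁ (u / (-1 / z₁)) (-1 / (-1 / z₁))) := by
    intro m₁
    simp only [thetaTerm, jacobiTheta₂_term, ← Complex.exp_add, Equiv.prodComm_apply,
      Prod.fst_swap, Prod.snd_swap, ← hv, hu]
    congr 1
    push_cast
    field_simp
    ring
  rw [tsum_congr hL, tsum_mul_left,
    ← (Equiv.subRight b₁).tsum_eq
      (fun m₁ => thetaTerm b₁ a₂ 0 b₂ z₁ z₂ z₃ (Equiv.prodComm ℤ ℤ (m₂, m₁)))]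
  simp only [Equiv.subRight_apply]
  rw [tsum_congr hR, tsum_mul_left, tsum_mul_left]
  have := jacobiTheta₂_functional_equation u (-1 / z₁)
  simp only [jacobiTheta₂] at this
  rw [this]
  ring

/-! ### The duplication formula -/

theorem theta_eq_thetaCoord (a b : Fin 2 → ZMod 2) {τ : Matrix (Fin 2) (Fin 2) ℂ}
    (h : τ 1 0 = τ 0 1) :
    theta a b τ = thetaCoord (a 0).val (a 1).val (b 0).val (b 1).val (τ 0 0) (τ 1 1) (τ 0 1) := by
  rw [thetaCoord, ← (finTwoArrowEquiv ℤ).tsum_eq, theta]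
  refine tsum_congr fun m => ?_
  rw [show finTwoArrowEquiv ℤ m = (m 0, m 1) from rfl]
  simp only [thetaTerm, dotProduct, mulVec, Fin.sum_univ_two, h]
  congr 1
  push_cast
  ring

theorem thetaCoord_congr_mod_two {b₁ b₂ c₁ c₂ : ℤ} (h₁ : b₁ ≡ c₁ [ZMOD 2])
    (h₂ : b₂ ≡ c₂ [ZMOD 2]) (z₁ z₂ z₃ : ℂ) :
    thetaCoord 0 0 b₁ b₂ z₁ z₂ z₃ = thetaCoord 0 0 c₁ c₂ z₁ z₂ z₃ := by
  obtain ⟨k, hk⟩ := h₁.symm.dvd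
  obtain ⟨l, hl⟩ := h₂.symm.dvd
  have hk' : (b₁ : ℂ) - c₁ = 2 * k := by exact_mod_cast hk
  have hl' : (b₂ : ℂ) - c₂ = 2 * l := by exact_mod_cast hl
  refine tsum_congr fun m => exp_pi_mul_I_mul_eq (k * m.1 + l * m.2) ?_
  push_cast
  linear_combination (m.1 : ℂ) * hk' + (m.2 : ℂ) * hl'

theorem exp_pi_mul_I_intCast_even {k : ℤ} (h : Even k) : cexp (Real.pi * I * k) = 1 := by
  obtain ⟨l, rfl⟩ := h
  rw [exp_pi_mul_I_mul_eq (y := 0) l (by push_cast; ring)]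
  simp

theorem exp_pi_mul_I_intCast_odd {k : ℤ} (h : Odd k) : cexp (Real.pi * I * k) = -1 := by
  obtain ⟨l, rfl⟩ := h
  rw [exp_pi_mul_I_mul_eq (y := 1) l (by push_cast; ring)]
  simp

/-- The duplication formula for the theta constants with `a = 0`. -/
theorem thetaCoord_duplication (b₁ b₂ : ℤ) {z₁ z₂ z₃ : ℂ} (h : IsSiegel z₁ z₂ z₃) :
    4 * thetaCoord 0 0 b₁ b₂ (2 * z₁) (2 * z₂) (2 * z₃) ^ 2 =
      ∑ c ∈ ({0, 1} : Finset ℤ) ×ˢ ({0, 1} : Finset ℤ),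
        thetaCoord 0 0 c.1 c.2 z₁ z₂ z₃ * thetaCoord 0 0 (b₁ + c.1) (b₂ + c.2) z₁ z₂ z₃ := by
  have h2 : IsSiegel (2 * z₁) (2 * z₂) (2 * z₃) := by
    obtain ⟨h₁, h₂⟩ := h
    refine ⟨by simpa using h₁, ?_⟩
    simp only [Complex.mul_im, Complex.re_ofNat, Complex.im_ofNat, zero_mul, add_zero]
    nlinarith
  have hs := fun c₁ c₂ => summable_norm_thetaTerm h 0 0 c₁ c₂
  have hs2 := summable_norm_thetaTerm h2 0 0 b₁ b₂
  simp only [thetaCoord, pow_two]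
  rw [tsum_mul_tsum_of_summable_norm hs2 hs2, ← tsum_mul_left]
  simp_rw [fun c₁ c₂ d₁ d₂ => tsum_mul_tsum_of_summable_norm (hs c₁ c₂) (hs d₁ d₂)]
  rw [← Summable.tsum_finsetSum fun c _ => summable_mul_of_summable_norm (hs _ _) (hs _ _)]
  set F : (ℤ × ℤ) × (ℤ × ℤ) → ℂ := fun x =>
    ∑ c ∈ ({0, 1} : Finset ℤ) ×ˢ ({0, 1} : Finset ℤ),
      thetaTerm 0 0 c.1 c.2 z₁ z₂ z₃ x.1 * thetaTerm 0 0 (b₁ + c.1) (b₂ + c.2) z₁ z₂ z₃ x.2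
    with hF
  -- The sum over c is a character sum: it equals 4 when both coordinates of x.1 + x.2 are even, and
  -- 0 otherwise.
  have hF' : ∀ x, F x = thetaTerm 0 0 0 0 z₁ z₂ z₃ x.1 * thetaTerm 0 0 b₁ b₂ z₁ z₂ z₃ x.2 *
      ((1 + cexp (Real.pi * I * (x.1.1 + x.2.1 : ℤ))) *
        (1 + cexp (Real.pi * I * (x.1.2 + x.2.2 : ℤ)))) := by
    intro x
    simp only [hF, Finset.sum_product, Finset.sum_pair zero_ne_one, thetaTerm, mul_add, add_mul,
      ← Complex.exp_add, one_mul, mul_one]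
    push_cast
    ring_nf
  -- The surviving pairs are exactly (p + q, p - q), and the parallelogram law Q(p + q) + Q(p - q) =
  -- 2Q(p) + 2Q(q) produces the series at 2τ.
  set φ : (ℤ × ℤ) × (ℤ × ℤ) → (ℤ × ℤ) × (ℤ × ℤ) := fun x => (x.1 + x.2, x.1 - x.2) with hφ
  have hinj : Function.Injective φ := by
    rintro ⟨⟨p₁, p₂⟩, q₁, q₂⟩ ⟨⟨p₁', p₂'⟩, q₁', q₂'⟩ hx
    simp only [hφ, Prod.mk_add_mk, Prod.mk_sub_mk, Prod.mk.injEq] at hx ⊢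
    omega
  have hsupp : Function.support F ⊆ Set.range φ := by
    intro x hx
    rw [Function.mem_support, hF'] at hx
    have h₁ : Even (x.1.1 + x.2.1) := by
      by_contra hodd
      rw [Int.not_even_iff_odd] at hodd
      exact hx (by rw [exp_pi_mul_I_intCast_odd hodd]; simp)
    have h₂ : Even (x.1.2 + x.2.2) := by
      by_contra hodd
      rw [Int.not_even_iff_odd] at hodd
      exact hx (by rw [exp_pi_mul_I_intCast_odd hodd]; simp)
    obtain ⟨k, hk⟩ := h₁
    obtain ⟨l, hl⟩ := h₂
    refine ⟨((k, l), (x.1.1 - k, x.1.2 - l)), ?_⟩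
    simp only [hφ, Prod.ext_iff, Prod.fst_add, Prod.snd_add, Prod.fst_sub, Prod.snd_sub]
    omega
  rw [← hinj.tsum_eq hsupp]
  refine tsum_congr fun x => ?_
  rw [hF', exp_pi_mul_I_intCast_even, exp_pi_mul_I_intCast_even]
  · have : thetaTerm 0 0 b₁ b₂ (2 * z₁) (2 * z₂) (2 * z₃) x.1 *
        thetaTerm 0 0 b₁ b₂ (2 * z₁) (2 * z₂) (2 * z₃) x.2 =
        thetaTerm 0 0 0 0 z₁ z₂ z₃ (φ x).1 * thetaTerm 0 0 b₁ b₂ z₁ z₂ z₃ (φ x).2 := by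
      simp only [thetaTerm, ← Complex.exp_add, ← mul_add, hφ]
      refine exp_pi_mul_I_mul_eq (b₁ * x.2.1 + b₂ * x.2.2) ?_
      push_cast [Prod.fst_add, Prod.snd_add, Prod.fst_sub, Prod.snd_sub]
      ring
    rw [this]
    ring
  · exact ⟨x.1.2, by simp [hφ]⟩
  · exact ⟨x.1.1, by simp [hφ]⟩

theorem val_add_modEq (x y : ZMod 2) : ((x.val : ℤ) + y.val) ≡ ((x + y).val : ℤ) [ZMOD 2] := by
  revert x y
  decide

/-- The duplication formula in the form of a Borchardt step. -/
theorem theta_two_smul_sq (b : Fin 2 → ZMod 2) {τ : Matrix (Fin 2) (Fin 2) ℂ}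
    (hsymm : τ 1 0 = τ 0 1) (h : IsSiegel (τ 0 0) (τ 1 1) (τ 0 1)) :
    theta 0 b ((2 : ℂ) • τ) ^ 2 =
      1 / 4 * ∑ p : (Fin 2 → ZMod 2) × (Fin 2 → ZMod 2) with p.1 + p.2 = b,
        theta 0 p.1 τ * theta 0 p.2 τ := by
  have h4 := thetaCoord_duplication (b 0).val (b 1).val h
  have hsymm2 : ((2 : ℂ) • τ) 1 0 = ((2 : ℂ) • τ) 0 1 := by simp [hsymm]
  have e1 : ∀ c, theta 0 c τ =
      thetaCoord 0 0 (c 0).val (c 1).val (τ 0 0) (τ 1 1) (τ 0 1) := fun c => by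
    rw [theta_eq_thetaCoord 0 c hsymm]; simp
  have e2 : theta 0 b ((2 : ℂ) • τ) =
      thetaCoord 0 0 (b 0).val (b 1).val (2 * τ 0 0) (2 * τ 1 1) (2 * τ 0 1) := by
    rw [theta_eq_thetaCoord 0 b hsymm2]; simp
  rw [e2]
  have hsum : ∑ p : (Fin 2 → ZMod 2) × (Fin 2 → ZMod 2) with p.1 + p.2 = b,
      theta 0 p.1 τ * theta 0 p.2 τ = ∑ c : Fin 2 → ZMod 2, theta 0 c τ * theta 0 (b + c) τ := by
    refine Finset.sum_bij' (fun p _ => p.1) (fun c _ => (c, b + c)) ?_ ?_ ?_ ?_ ?_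
    · simp
    · intro c _
      simp only [Finset.mem_filter, Finset.mem_univ, true_and]
      rw [add_comm b c, ← add_assoc, CharTwo.add_self_eq_zero, zero_add]
    · rintro ⟨c, d⟩ hp
      simp only [Finset.mem_filter, Finset.mem_univ, true_and] at hp
      simp only [Prod.mk.injEq, true_and]
      rw [← hp, add_comm c d, add_assoc, CharTwo.add_self_eq_zero, add_zero]
    · simp
    · rintro ⟨c, d⟩ hp
      simp only [Finset.mem_filter, Finset.mem_univ, true_and] at hp
      simp only
      rw [← hp, add_comm c d, add_assoc, CharTwo.add_self_eq_zero, add_zero]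
  have hstep : ∀ c : Fin 2 → ZMod 2, theta 0 c τ * theta 0 (b + c) τ =
      thetaCoord 0 0 (c 0).val (c 1).val (τ 0 0) (τ 1 1) (τ 0 1) *
        thetaCoord 0 0 ((b 0).val + (c 0).val) ((b 1).val + (c 1).val)
          (τ 0 0) (τ 1 1) (τ 0 1) := by
    intro c
    rw [e1, e1, thetaCoord_congr_mod_two (val_add_modEq (b 0) (c 0)) (val_add_modEq (b 1) (c 1))]
    rfl
  rw [hsum, Finset.sum_congr rfl fun c _ => hstep c,
    ← (finTwoArrowEquiv (ZMod 2)).symm.sum_comp, Fintype.sum_prod_type]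
  rw [Finset.sum_product] at h4
  simp only [Finset.sum_pair zero_ne_one] at h4
  have hz : ∀ f : ZMod 2 → ℂ, ∑ x, f x = f 0 + f 1 := fun f => Fin.sum_univ_two f
  simp only [hz, finTwoArrowEquiv_symm_apply, Matrix.cons_val_zero, Matrix.cons_val_one,
    ZMod.val_zero, ZMod.val_one]
  push_cast
  linear_combination (1 / 4 : ℂ) * h4

/-! ### Numerical estimates for reduced imaginary part -/

/-- The finite box on which the terms of the theta series are estimated one by one. -/
noncomputable def box : Finset (ℤ × ℤ) := Finset.Icc (-3) 3 ×ˢ Finset.Icc (-3) 3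

theorem hasSum_ite_mem {α E : Type*} [DecidableEq α] [NormedAddCommGroup E] (s : Finset α)
    (f : α → E) : HasSum (fun m => if m ∈ s then f m else 0) (∑ m ∈ s, f m) := by
  have h : HasSum (fun m => if m ∈ s then f m else 0) (∑ m ∈ s, if m ∈ s then f m else 0) :=
    hasSum_sum_of_ne_finset_zero fun m hm => if_neg hm
  rwa [Finset.sum_congr rfl fun m hm => if_pos hm] at h

/-- A theta-like series is approximated by a finite part of it, provided that its terms decay at
least like powers of a small number `p`. -/
theorem norm_tsum_sub_sum_le {f : ℤ × ℤ → ℂ} {p : ℝ} {C : ℚ} {M : ℤ × ℤ → ℕ} (c : ℕ)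
    (S : Finset (ℤ × ℤ)) (hs : Summable f) (hp₀ : 0 ≤ p) (hp : p ≤ 257 / 1000)
    (hf : ∀ m, ‖f m‖ ≤ p ^ M m) (hM : ∀ m ∈ box \ S, c ≤ M m)
    (hM' : ∀ m ∉ box, 6 + (m.1.natAbs + m.2.natAbs) ≤ M m) (hc : c ≤ 6)
    (hC : ∑ m ∈ box \ S, (257 / 1000 : ℚ) ^ (M m - c) + 3 * (257 / 1000) ^ (6 - c) ≤ C) :
    ‖∑' m, f m - ∑ m ∈ S, f m‖ ≤ p ^ c * C := by
  set g : ℤ × ℤ → ℂ := fun m => if m ∈ S then 0 else f m with hg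
  have hgsum : HasSum g (∑' m, f m - ∑ m ∈ S, f m) := by
    have h1 := hs.hasSum.sub (hasSum_ite_mem S f)
    have h2 : (fun m => f m - if m ∈ S then f m else 0) = g := by
      funext m
      by_cases hm : m ∈ S <;> simp [hg, hm]
    rwa [h2] at h1
  rw [← hgsum.tsum_eq]
  set p₀ : ℝ := 257 / 1000 with hp₀def
  -- The geometric majorant is spread over all of ℤ², box included. Its sum ((1 + p₀)/(1 - p₀))² is
  -- below 3, whence the 3 in `hC`.
  have hgeo := (hasSum_pow_natAbs_prod (ρ := p₀) (by norm_num [p₀]) (by norm_num [p₀])).mul_left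
    (p₀ ^ (6 - c))
  have hfin := hasSum_ite_mem (box \ S) fun m => p₀ ^ (M m - c)
  have hmaj := (hfin.add hgeo).mul_left (p ^ c)
  have hpow : ∀ n, c ≤ n → p ^ n ≤ p ^ c * p₀ ^ (n - c) := by
    intro n hn
    rw [← Nat.add_sub_cancel' hn, pow_add, Nat.add_sub_cancel_left]
    gcongr
  refine (tsum_of_norm_bounded hmaj fun m => ?_).trans ?_
  · have hnn : 0 ≤ p₀ ^ (6 - c) * p₀ ^ (m.1.natAbs + m.2.natAbs) := by positivity
    by_cases hm : m ∈ S
    · simp only [hg, hm, if_true, norm_zero]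
      refine mul_nonneg (by positivity) (add_nonneg ?_ hnn)
      split_ifs <;> positivity
    · simp only [hg, hm, if_false]
      by_cases hb : m ∈ box
      · have hb' : m ∈ box \ S := Finset.mem_sdiff.2 ⟨hb, hm⟩
        rw [if_pos hb']
        refine (hf m).trans ((hpow _ (hM m hb')).trans ?_)
        exact mul_le_mul_of_nonneg_left (by linarith) (by positivity)
      · have hb' : m ∉ box \ S := fun h => hb (Finset.mem_sdiff.1 h).1
        rw [if_neg hb', zero_add, ← pow_add]
        have hp1 : p ≤ 1 := hp.trans (by norm_num [p₀])
        refine (hf m).trans ((pow_le_pow_of_le_one hp₀ hp1 (hM' m hb)).trans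
          ((hpow _ (by omega)).trans (le_of_eq ?_)))
        congr 2
        omega
  · have hC' : (∑ m ∈ box \ S, p₀ ^ (M m - c) + 3 * p₀ ^ (6 - c) : ℝ) ≤ C := by
      have := (Rat.cast_le (K := ℝ)).2 hC
      push_cast at this
      exact this
    refine mul_le_mul_of_nonneg_left (le_trans ?_ hC') (by positivity)
    have : ((1 + p₀) / (1 - p₀)) ^ 2 ≤ 3 := by norm_num [p₀]
    have h0 : 0 ≤ p₀ ^ (6 - c) := by positivity
    nlinarith

/-- A reduced imaginary part, with minimum at least `y`. -/
structure IsReduced (y : ℝ) (z₁ z₂ z₃ : ℂ) : Prop where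
  le : √3 / 2 ≤ y
  le₁ : y ≤ z₁.im
  le₂ : y ≤ z₂.im
  nonneg : 0 ≤ z₃.im
  two_mul_le : 2 * z₃.im ≤ y

theorem IsReduced.pos {y : ℝ} {z₁ z₂ z₃ : ℂ} (h : IsReduced y z₁ z₂ z₃) : 0 < y :=
  lt_of_lt_of_le (by positivity) h.le

theorem IsReduced.isSiegel {y : ℝ} {z₁ z₂ z₃ : ℂ} (h : IsReduced y z₁ z₂ z₃) :
    IsSiegel z₁ z₂ z₃ := by
  have hy := h.pos
  refine ⟨hy.trans_le h.le₁, ?_⟩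
  have := mul_le_mul h.le₁ h.le₂ hy.le (hy.le.trans h.le₁)
  nlinarith [h.nonneg, h.two_mul_le]

theorem IsReduced.swap {y : ℝ} {z₁ z₂ z₃ : ℂ} (h : IsReduced y z₁ z₂ z₃) :
    IsReduced y z₂ z₁ z₃ :=
  ⟨h.le, h.le₂, h.le₁, h.nonneg, h.two_mul_le⟩

/-- The nome `exp (-π y / 2)`. -/
noncomputable def nome (y : ℝ) : ℝ := Real.exp (-Real.pi * y / 2)

theorem nome_pos (y : ℝ) : 0 < nome y := Real.exp_pos _

/-- The worst case is y = √3/2, where π·y/2 exceeds 1.36 and exp(-1.36) < 0.257. -/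
theorem nome_le {y : ℝ} (h : √3 / 2 ≤ y) : nome y ≤ 257 / 1000 := by
  have h3 : (1.732 : ℝ) ≤ √3 := Real.le_sqrt_of_sq_le (by norm_num)
  have h1 : (1.36 : ℝ) ≤ Real.pi * y / 2 := by nlinarith [Real.pi_gt_d4]
  have h2 : (1000 / 257 : ℝ) ≤ Real.exp (Real.pi * y / 2) := by
    refine le_trans ?_ (Real.exp_le_exp.2 h1)
    refine le_trans ?_ (Real.sum_le_exp_of_nonneg (by norm_num) 9)
    norm_num [Finset.sum_range_succ, Nat.factorial]
  rw [nome, show -Real.pi * y / 2 = -(Real.pi * y / 2) by ring, Real.exp_neg,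
    inv_le_comm₀ (Real.exp_pos _) (by norm_num)]
  simpa using h2

theorem exp_neg_pi_mul_le {y X : ℝ} {E : ℤ} (hE : 0 ≤ E) (h : y / 2 * E ≤ X) :
    Real.exp (-Real.pi * X) ≤ nome y ^ E.toNat := by
  have hE' : ((E.toNat : ℕ) : ℝ) = E := by exact_mod_cast Int.toNat_of_nonneg hE
  rw [nome, ← Real.exp_nat_mul, Real.exp_le_exp, hE']
  nlinarith [Real.pi_pos]

theorem sq_sub_abs_nonneg (m : ℤ) : 0 ≤ |m| ^ 2 - |m| := by
  rcases (abs_nonneg m).eq_or_lt with h | h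
  · rw [← h]; simp
  · nlinarith [show 1 ≤ |m| from h]

/-- If one coordinate is at least 4 in absolute value, it contributes at least 8 to the sum of the
|mᵢ|² - 2|mᵢ|, and the other contributes at least -1. -/
theorem le_of_notMem_box {m : ℤ × ℤ} (hm : m ∉ box) {E : ℤ}
    (hE : |m.1| ^ 2 - |m.1| + (|m.2| ^ 2 - |m.2|) ≤ E) :
    6 + (m.1.natAbs + m.2.natAbs) ≤ E.toNat := by
  have h : 4 ≤ |m.1| ∨ 4 ≤ |m.2| := by
    by_contra! hcon
    refine hm (Finset.mem_product.2 ⟨Finset.mem_Icc.2 ?_, Finset.mem_Icc.2 ?_⟩)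
    · rw [← abs_le]; omega
    · rw [← abs_le]; omega
  have h' : 6 + |m.1| + |m.2| ≤ E := by
    rcases h with h | h
    · nlinarith [sq_nonneg (|m.2| - 1)]
    · nlinarith [sq_nonneg (|m.1| - 1)]
  have h1 := Int.natCast_natAbs m.1
  have h2 := Int.natCast_natAbs m.2
  rw [← h1, ← h2] at h'
  clear hE h hm
  omega

/-- Exponents bounding the terms of the theta series with `a = (0, 0)`. -/
def expo₀₀ (m : ℤ × ℤ) : ℤ := 2 * (m.1 ^ 2 + m.2 ^ 2 + min 0 (m.1 * m.2))

/-- Exponents bounding the terms of the theta series with `a = (1, 0)`. -/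
def expo₁₀ (m : ℤ × ℤ) : ℤ :=
  2 * m.1 ^ 2 + 2 * m.1 + 2 * m.2 ^ 2 + min 0 ((2 * m.1 + 1) * m.2)

/-- Exponents bounding the terms of the theta series with `a = (1, 1)`. -/
def expo₁₁ (m : ℤ × ℤ) : ℤ :=
  2 * m.1 ^ 2 + 2 * m.1 + 2 * m.2 ^ 2 + 2 * m.2 + min 0 (2 * m.1 * m.2 + m.1 + m.2 + 1)

theorem le_expo₀₀ (m : ℤ × ℤ) : |m.1| ^ 2 - |m.1| + (|m.2| ^ 2 - |m.2|) ≤ expo₀₀ m := by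
  rw [expo₀₀, sq_abs, sq_abs]
  rcases min_choice 0 (m.1 * m.2) with h | h <;> rw [h] <;>
    nlinarith [abs_nonneg m.1, abs_nonneg m.2, sq_nonneg (m.1 + m.2), sq_nonneg m.1,
      sq_nonneg m.2]

theorem le_expo₁₀ (m : ℤ × ℤ) : |m.1| ^ 2 - |m.1| + (|m.2| ^ 2 - |m.2|) ≤ expo₁₀ m := by
  rw [expo₁₀, sq_abs, sq_abs]
  have h1 := neg_abs_le m.1
  have h2 := sq_sub_abs_nonneg m.1
  rw [sq_abs] at h2
  rcases min_choice 0 ((2 * m.1 + 1) * m.2) with h | h <;> rw [h]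
  · nlinarith [abs_nonneg m.2, sq_nonneg m.2]
  · have h3 : 4 * (2 * m.1 ^ 2 + 2 * m.1 + 2 * m.2 ^ 2 + (2 * m.1 + 1) * m.2) + 1
        = (2 * m.1 + 1 + 2 * m.2) ^ 2 + 4 * (m.1 ^ 2 + m.1 + m.2 ^ 2) := by ring
    have h4 := sq_nonneg (2 * m.1 + 1 + 2 * m.2)
    have h5 := abs_nonneg m.2
    omega

theorem le_expo₁₁ (m : ℤ × ℤ) : |m.1| ^ 2 - |m.1| + (|m.2| ^ 2 - |m.2|) ≤ expo₁₁ m := by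
  rw [expo₁₁, sq_abs, sq_abs]
  have h1 := neg_abs_le m.1
  have h2 := neg_abs_le m.2
  have h3 := sq_sub_abs_nonneg m.1
  have h4 := sq_sub_abs_nonneg m.2
  rw [sq_abs] at h3 h4
  rcases min_choice 0 (2 * m.1 * m.2 + m.1 + m.2 + 1) with h | h <;> rw [h]
  · omega
  · nlinarith [sq_nonneg (m.1 + m.2 + 1)]

theorem expo_nonneg {m : ℤ × ℤ} {E : ℤ}
    (hE : |m.1| ^ 2 - |m.1| + (|m.2| ^ 2 - |m.2|) ≤ E) : 0 ≤ E :=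
  (add_nonneg (sq_sub_abs_nonneg _) (sq_sub_abs_nonneg _)).trans hE

/-- The cross term of the quadratic form is linear in Im z₃, so its worst case is at an end of the
allowed interval. This is the origin of the minima in `expo₀₀`, `expo₁₀` and `expo₁₁`. -/
theorem mul_min_le {y t : ℝ} (ht : 0 ≤ t) (hty : t ≤ y) (k : ℤ) :
    y * ((min 0 k : ℤ) : ℝ) ≤ t * k := by
  rcases le_total 0 k with h | h
  · have : (0 : ℝ) ≤ k := by exact_mod_cast h
    rw [min_eq_left h]; push_cast; nlinarith
  · have : (k : ℝ) ≤ 0 := by exact_mod_cast h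
    rw [min_eq_right h]; nlinarith

theorem intCast_sq_add_nonneg (m : ℤ) : (0 : ℝ) ≤ (m : ℝ) ^ 2 + m := by
  have h2 := sq_sub_abs_nonneg m
  have h1 := neg_abs_le m
  rw [sq_abs] at h2
  have : 0 ≤ m ^ 2 + m := by omega
  exact_mod_cast this

theorem norm_thetaTerm₀₀_le {y : ℝ} {z₁ z₂ z₃ : ℂ} (h : IsReduced y z₁ z₂ z₃) (b₁ b₂ : ℤ)
    (m : ℤ × ℤ) :
    ‖thetaTerm 0 0 b₁ b₂ z₁ z₂ z₃ m‖ ≤ nome y ^ (expo₀₀ m).toNat := by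
  rw [norm_thetaTerm]
  refine exp_neg_pi_mul_le (expo_nonneg (le_expo₀₀ m)) ?_
  have h1 := mul_min_le (t := 2 * z₃.im) (by linarith [h.nonneg]) h.two_mul_le (m.1 * m.2)
  have h2 := mul_le_mul_of_nonneg_right h.le₁ (sq_nonneg (m.1 : ℝ))
  have h3 := mul_le_mul_of_nonneg_right h.le₂ (sq_nonneg (m.2 : ℝ))
  simp only [expo₀₀]
  push_cast at h1 ⊢
  nlinarith

/-- The term of the theta series with `a = (1, 0)`, normalised by the leading term. -/
noncomputable def normTerm₁₀ (b₂ : ℤ) (z₁ z₂ z₃ : ℂ) (m : ℤ × ℤ) : ℂ :=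
  cexp (-(Real.pi * I * (z₁ / 4))) * thetaTerm 1 0 0 b₂ z₁ z₂ z₃ m

/-- The term of the theta series with `a = (1, 1)`, normalised by the leading term. -/
noncomputable def normTerm₁₁ (z₁ z₂ z₃ : ℂ) (m : ℤ × ℤ) : ℂ :=
  cexp (-(Real.pi * I * ((z₁ + z₂ - 2 * z₃) / 4))) * thetaTerm 1 1 0 0 z₁ z₂ z₃ m

theorem norm_cexp_pi_mul_I (z : ℂ) : ‖cexp (Real.pi * I * z)‖ = Real.exp (-Real.pi * z.im) := by
  rw [Complex.norm_exp]; simp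

theorem norm_normTerm₁₀_le {y : ℝ} {z₁ z₂ z₃ : ℂ} (h : IsReduced y z₁ z₂ z₃) (b₂ : ℤ)
    (m : ℤ × ℤ) : ‖normTerm₁₀ b₂ z₁ z₂ z₃ m‖ ≤ nome y ^ (expo₁₀ m).toNat := by
  have him : (z₁ / 4).im = z₁.im / 4 := by simp
  rw [normTerm₁₀, norm_mul, norm_thetaTerm, ← mul_neg, norm_cexp_pi_mul_I, ← Real.exp_add,
    ← mul_add, Complex.neg_im, him]
  refine exp_neg_pi_mul_le (expo_nonneg (le_expo₁₀ m)) ?_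
  have h1 := mul_min_le h.nonneg (y := y / 2) (by linarith [h.two_mul_le]) ((2 * m.1 + 1) * m.2)
  have h2 := mul_le_mul_of_nonneg_right h.le₁ (intCast_sq_add_nonneg m.1)
  have h3 := mul_le_mul_of_nonneg_right h.le₂ (sq_nonneg (m.2 : ℝ))
  simp only [expo₁₀]
  push_cast at h1 ⊢
  nlinarith

theorem norm_normTerm₁₁_le {y : ℝ} {z₁ z₂ z₃ : ℂ} (h : IsReduced y z₁ z₂ z₃)
    (m : ℤ × ℤ) : ‖normTerm₁₁ z₁ z₂ z₃ m‖ ≤ nome y ^ (expo₁₁ m).toNat := by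
  have him : ((z₁ + z₂ - 2 * z₃) / 4).im = (z₁.im + z₂.im - 2 * z₃.im) / 4 := by simp
  rw [normTerm₁₁, norm_mul, norm_thetaTerm, ← mul_neg, norm_cexp_pi_mul_I, ← Real.exp_add,
    ← mul_add, Complex.neg_im, him]
  refine exp_neg_pi_mul_le (expo_nonneg (le_expo₁₁ m)) ?_
  have h1 := mul_min_le h.nonneg (y := y / 2) (by linarith [h.two_mul_le])
    (2 * m.1 * m.2 + m.1 + m.2 + 1)
  have h2 := mul_le_mul_of_nonneg_right h.le₁ (intCast_sq_add_nonneg m.1)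
  have h3 := mul_le_mul_of_nonneg_right h.le₂ (intCast_sq_add_nonneg m.2)
  simp only [expo₁₁]
  push_cast at h1 ⊢
  nlinarith

/-- The indices of the leading terms of the theta series with `a = (0, 0)`. -/
def lead₀₀ : Finset (ℤ × ℤ) := {(0, 0), (1, 0), (-1, 0), (0, 1), (0, -1), (1, -1), (-1, 1)}

/-- The indices of the leading terms of the theta series with `a = (1, 0)`. -/
def lead₁₀ : Finset (ℤ × ℤ) := {(0, 0), (-1, 0), (0, -1), (-1, 1), (0, 1), (-1, -1)}

/-- The indices of the leading terms of the theta series with `a = (1, 1)`. -/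
def lead₁₁ : Finset (ℤ × ℤ) := {(0, 0), (-1, -1), (0, -1), (-1, 0)}

/-- This and the following bounds are finite rational computations at the largest possible nome
257/1000. The subtracted exponents 4, 3, 3 are orders, as powers of the nome, to which all terms
outside the leading sets are small. -/
theorem sum_expo₀₀_le : ∑ m ∈ box \ {(0, 0)}, (257 / 1000 : ℚ) ^ ((expo₀₀ m).toNat - 0) +
    3 * (257 / 1000) ^ (6 - 0) ≤ 41 / 100 := by decide +kernel

theorem four_le_expo₀₀ : ∀ m ∈ box \ lead₀₀, 4 ≤ (expo₀₀ m).toNat := by decide +kernel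

theorem sum_expo₀₀_sub_four_le : ∑ m ∈ box \ lead₀₀, (257 / 1000 : ℚ) ^ ((expo₀₀ m).toNat - 4) +
    3 * (257 / 1000) ^ (6 - 4) ≤ 26 / 10 := by decide +kernel

theorem three_le_expo₁₀ : ∀ m ∈ box \ lead₁₀, 3 ≤ (expo₁₀ m).toNat := by decide +kernel

theorem sum_expo₁₀_sub_three_le : ∑ m ∈ box \ lead₁₀, (257 / 1000 : ℚ) ^ ((expo₁₀ m).toNat - 3) +
    3 * (257 / 1000) ^ (6 - 3) ≤ 28 / 10 := by decide +kernel

theorem three_le_expo₁₁ : ∀ m ∈ box \ lead₁₁, 3 ≤ (expo₁₁ m).toNat := by decide +kernel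

theorem sum_expo₁₁_sub_three_le : ∑ m ∈ box \ lead₁₁, (257 / 1000 : ℚ) ^ ((expo₁₁ m).toNat - 3) +
    3 * (257 / 1000) ^ (6 - 3) ≤ 57 / 10 := by decide +kernel

theorem norm_thetaCoord₀₀_sub_one_le {y : ℝ} {z₁ z₂ z₃ : ℂ} (h : IsReduced y z₁ z₂ z₃)
    (b₁ b₂ : ℤ) : ‖thetaCoord 0 0 b₁ b₂ z₁ z₂ z₃ - 1‖ ≤ 41 / 100 := by
  have key := norm_tsum_sub_sum_le (C := 41 / 100) 0 {(0, 0)}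
    (summable_norm_thetaTerm h.isSiegel 0 0 b₁ b₂).of_norm (nome_pos y).le (nome_le h.le)
    (norm_thetaTerm₀₀_le h b₁ b₂) (fun _ _ => Nat.zero_le _)
    (fun m hm => le_of_notMem_box hm (le_expo₀₀ m)) (by norm_num) sum_expo₀₀_le
  simpa [thetaTerm, thetaCoord] using key

/-- The three exponentials are kept because one case of the comparison with θ_{(1,1),0} depends on
their phases, not just on the bound 41/100. -/
theorem exists_thetaCoord₀₀_eq {y : ℝ} {z₁ z₂ z₃ : ℂ} (h : IsReduced y z₁ z₂ z₃) :
    ∃ ρ : ℂ, ‖ρ‖ ≤ nome y ^ 4 * (26 / 10) ∧ thetaCoord 0 0 0 0 z₁ z₂ z₃ =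
      1 + 2 * cexp (Real.pi * I * z₁) + 2 * cexp (Real.pi * I * z₂)
        + 2 * cexp (Real.pi * I * (z₁ + z₂ - 2 * z₃)) + ρ := by
  have key := norm_tsum_sub_sum_le (C := 26 / 10) 4 lead₀₀
    (summable_norm_thetaTerm h.isSiegel 0 0 0 0).of_norm (nome_pos y).le (nome_le h.le)
    (norm_thetaTerm₀₀_le h 0 0) four_le_expo₀₀
    (fun m hm => le_of_notMem_box hm (le_expo₀₀ m)) (by norm_num) sum_expo₀₀_sub_four_le
  push_cast at key
  refine ⟨_, key, ?_⟩
  have e : ∀ m k, z₁ * (m.1 + (0 : ℤ) / 2) ^ 2 + 2 * z₃ * (m.1 + (0 : ℤ) / 2) * (m.2 + (0 : ℤ) / 2)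
      + z₂ * (m.2 + (0 : ℤ) / 2) ^ 2 + (0 : ℤ) * (m.1 + (0 : ℤ) / 2)
      + (0 : ℤ) * (m.2 + (0 : ℤ) / 2) = k →
        thetaTerm 0 0 0 0 z₁ z₂ z₃ m = cexp (Real.pi * I * k) := by
    intro m k hk
    rw [thetaTerm, hk]
  rw [lead₀₀, Finset.sum_insert (by decide), Finset.sum_insert (by decide),
    Finset.sum_insert (by decide),
    Finset.sum_insert (by decide), Finset.sum_insert (by decide), Finset.sum_insert (by decide),
    Finset.sum_singleton, thetaCoord, e (0, 0) 0 (by push_cast; ring),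
    e (1, 0) z₁ (by push_cast; ring), e (-1, 0) z₁ (by push_cast; ring),
    e (0, 1) z₂ (by push_cast; ring), e (0, -1) z₂ (by push_cast; ring),
    e (1, -1) (z₁ + z₂ - 2 * z₃) (by push_cast; ring),
    e (-1, 1) (z₁ + z₂ - 2 * z₃) (by push_cast; ring)]
  simp only [mul_zero, Complex.exp_zero]
  ring

theorem nome_sq (y : ℝ) : nome y ^ 2 = Real.exp (-Real.pi * y) := by
  rw [nome, ← Real.exp_nat_mul]; congr 1; push_cast; ring

theorem exp_neg_pi_im_le_one {y : ℝ} {z₁ z₂ z₃ : ℂ} (h : IsReduced y z₁ z₂ z₃) :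
    Real.exp (-Real.pi * z₃.im) ≤ 1 := by
  rw [Real.exp_le_one_iff]; nlinarith [Real.pi_pos, h.nonneg]

theorem nome_le_exp_neg_pi_im {y : ℝ} {z₁ z₂ z₃ : ℂ} (h : IsReduced y z₁ z₂ z₃) :
    nome y ≤ Real.exp (-Real.pi * z₃.im) := by
  rw [nome, Real.exp_le_exp]; nlinarith [Real.pi_pos, h.two_mul_le]

theorem exists_thetaCoord₁₀_eq {y : ℝ} {z₁ z₂ z₃ : ℂ} (h : IsReduced y z₁ z₂ z₃) (b₂ : ℤ) :
    ∃ η : ℂ, ‖η‖ ≤ 3 / 10 ∧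
      thetaCoord 1 0 0 b₂ z₁ z₂ z₃ = 2 * cexp (Real.pi * I * (z₁ / 4)) * (1 + η) := by
  have hs := (summable_norm_thetaTerm h.isSiegel 1 0 0 b₂).of_norm
  have key := norm_tsum_sub_sum_le (f := normTerm₁₀ b₂ z₁ z₂ z₃) (C := 28 / 10) 3 lead₁₀
    (hs.mul_left _) (nome_pos y).le (nome_le h.le)
    (norm_normTerm₁₀_le h b₂) three_le_expo₁₀
    (fun m hm => le_of_notMem_box hm (le_expo₁₀ m)) (by norm_num) sum_expo₁₀_sub_three_le
  have hθ : thetaCoord 1 0 0 b₂ z₁ z₂ z₃ =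
      cexp (Real.pi * I * (z₁ / 4)) * ∑' m, normTerm₁₀ b₂ z₁ z₂ z₃ m := by
    simp only [normTerm₁₀, tsum_mul_left, ← mul_assoc, ← Complex.exp_add, add_neg_cancel,
      Complex.exp_zero, one_mul, thetaCoord]
  obtain ⟨ρ, hρ⟩ : ∃ ρ, ρ = ∑' m, normTerm₁₀ b₂ z₁ z₂ z₃ m -
    ∑ m ∈ lead₁₀, normTerm₁₀ b₂ z₁ z₂ z₃ m :=
      ⟨_, rfl⟩
  rw [← hρ] at key
  set w := cexp (Real.pi * I * (z₂ - z₃ + b₂)) with hw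
  set w' := cexp (Real.pi * I * (z₂ + z₃ + b₂)) with hw'
  have hsum : ∑ m ∈ lead₁₀,
      normTerm₁₀ b₂ z₁ z₂ z₃ m = 2 + 2 * w + 2 * w' := by
    rw [lead₁₀, Finset.sum_insert (by decide), Finset.sum_insert (by decide),
      Finset.sum_insert (by decide), Finset.sum_insert (by decide),
      Finset.sum_insert (by decide), Finset.sum_singleton]
    have e : ∀ m k, Real.pi * I * (z₁ * (m.1 + (1 : ℤ) / 2) ^ 2 +
        2 * z₃ * (m.1 + (1 : ℤ) / 2) * (m.2 + (0 : ℤ) / 2)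
        + z₂ * (m.2 + (0 : ℤ) / 2) ^ 2 + (0 : ℤ) * (m.1 + (1 : ℤ) / 2) + b₂ * (m.2 + (0 : ℤ) / 2))
        = Real.pi * I * (z₁ / 4) + Real.pi * I * k → normTerm₁₀ b₂ z₁ z₂ z₃ m =
          cexp (Real.pi * I * k) := by
      intro m k hk
      rw [normTerm₁₀, thetaTerm, hk, ← Complex.exp_add, neg_add_cancel_left]
    rw [e (0, 0) 0 (by push_cast; ring), e (-1, 0) 0 (by push_cast; ring),
      e (0, -1) (z₂ - z₃ - b₂) (by push_cast; ring), e (-1, 1) (z₂ - z₃ + b₂) (by push_cast; ring),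
      e (0, 1) (z₂ + z₃ + b₂) (by push_cast; ring), e (-1, -1) (z₂ + z₃ - b₂) (by push_cast; ring),
      exp_pi_mul_I_mul_eq (x := z₂ - z₃ - b₂) (y := z₂ - z₃ + b₂) (-b₂) (by push_cast; ring),
      exp_pi_mul_I_mul_eq (x := z₂ + z₃ - b₂) (y := z₂ + z₃ + b₂) (-b₂) (by push_cast; ring)]
    simp only [mul_zero, Complex.exp_zero]
    ring
  refine ⟨w + w' + ρ / 2, ?_, ?_⟩
  · set p := nome y
    set r := Real.exp (-Real.pi * z₃.im) with hr
    have hp := nome_pos y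
    have hp' := nome_le h.le
    have hpr : p ≤ r := nome_le_exp_neg_pi_im h
    have hr1 : r ≤ 1 := exp_neg_pi_im_le_one h
    have hr0 : 0 < r := Real.exp_pos _
    have hz₂ : Real.exp (-Real.pi * z₂.im) ≤ p ^ 2 := by
      rw [nome_sq, Real.exp_le_exp]; nlinarith [h.le₂, Real.pi_pos]
    have h1 : ‖w‖ ≤ p ^ 2 / r := by
      rw [hw, norm_cexp_pi_mul_I, le_div_iff₀ hr0, hr, ← Real.exp_add]
      refine le_trans (le_of_eq ?_) hz₂
      congr 1; simp; ring
    have h2 : ‖w'‖ ≤ p ^ 2 * r := by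
      rw [hw', norm_cexp_pi_mul_I]
      refine le_trans (le_of_eq ?_) (mul_le_mul_of_nonneg_right hz₂ hr0.le)
      rw [hr, ← Real.exp_add]
      congr 1; simp; ring
    -- On [p, 1] the function r + 1/r is largest at r = p. The total is then at most p + p³ + 1.4·p³
    -- < 0.3.
    have h3 : p ^ 2 / r + p ^ 2 * r ≤ p + p ^ 3 := by
      have : p + p ^ 3 - (p ^ 2 / r + p ^ 2 * r) = p * (r - p) * (1 - p * r) / r := by
        field_simp; ring
      have : 0 ≤ p * (r - p) * (1 - p * r) / r := by
        have : 0 ≤ 1 - p * r := by nlinarith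
        have : 0 ≤ r - p := by linarith
        positivity
      linarith
    have h4 : p ^ 3 ≤ (257 / 1000) ^ 3 := pow_le_pow_left₀ hp.le hp' 3
    have h5 : ‖w + w' + ρ / 2‖ ≤ ‖w‖ + ‖w'‖ + ‖ρ‖ / 2 := by
      refine (norm_add₃_le).trans (le_of_eq ?_)
      simp
    push_cast at key
    norm_num at h4 hp' ⊢
    linarith
  · rw [hθ, show ∑' m, normTerm₁₀ b₂ z₁ z₂ z₃ m = ρ + (2 + 2 * w + 2 * w') by
      rw [← hsum, hρ]; ring]
    ring

theorem exists_thetaCoord₁₁_eq {y : ℝ} {z₁ z₂ z₃ : ℂ} (h : IsReduced y z₁ z₂ z₃) :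
    ∃ ε : ℂ, ‖ε‖ ≤ nome y ^ 3 * (285 / 100) ∧ thetaCoord 1 1 0 0 z₁ z₂ z₃ =
      2 * cexp (Real.pi * I * ((z₁ + z₂ - 2 * z₃) / 4)) * (1 + cexp (Real.pi * I * z₃) + ε) := by
  have hs := (summable_norm_thetaTerm h.isSiegel 1 1 0 0).of_norm
  have key := norm_tsum_sub_sum_le (f := normTerm₁₁ z₁ z₂ z₃) (C := 57 / 10) 3 lead₁₁
    (hs.mul_left _) (nome_pos y).le (nome_le h.le)
    (norm_normTerm₁₁_le h) three_le_expo₁₁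
    (fun m hm => le_of_notMem_box hm (le_expo₁₁ m)) (by norm_num) sum_expo₁₁_sub_three_le
  have hθ : thetaCoord 1 1 0 0 z₁ z₂ z₃ =
      cexp (Real.pi * I * ((z₁ + z₂ - 2 * z₃) / 4)) * ∑' m, normTerm₁₁ z₁ z₂ z₃ m := by
    simp only [normTerm₁₁, tsum_mul_left, ← mul_assoc, ← Complex.exp_add, add_neg_cancel,
      Complex.exp_zero, one_mul, thetaCoord]
  obtain ⟨ρ, hρ⟩ : ∃ ρ, ρ = ∑' m, normTerm₁₁ z₁ z₂ z₃ m -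
    ∑ m ∈ lead₁₁, normTerm₁₁ z₁ z₂ z₃ m := ⟨_, rfl⟩
  rw [← hρ] at key
  have hsum : ∑ m ∈ lead₁₁, normTerm₁₁ z₁ z₂ z₃ m =
      2 + 2 * cexp (Real.pi * I * z₃) := by
    rw [lead₁₁, Finset.sum_insert (by decide), Finset.sum_insert (by decide),
      Finset.sum_insert (by decide), Finset.sum_singleton]
    have e : ∀ m k, Real.pi * I * (z₁ * (m.1 + (1 : ℤ) / 2) ^ 2 +
        2 * z₃ * (m.1 + (1 : ℤ) / 2) * (m.2 + (1 : ℤ) / 2)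
        + z₂ * (m.2 + (1 : ℤ) / 2) ^ 2 + (0 : ℤ) * (m.1 + (1 : ℤ) / 2)
        + (0 : ℤ) * (m.2 + (1 : ℤ) / 2))
        = Real.pi * I * ((z₁ + z₂ - 2 * z₃) / 4) + Real.pi * I * k →
          normTerm₁₁ z₁ z₂ z₃ m = cexp (Real.pi * I * k) := by
      intro m k hk
      rw [normTerm₁₁, thetaTerm, hk, ← Complex.exp_add, neg_add_cancel_left]
    rw [e (0, 0) z₃ (by push_cast; ring), e (-1, -1) z₃ (by push_cast; ring),
      e (0, -1) 0 (by push_cast; ring), e (-1, 0) 0 (by push_cast; ring)]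
    simp only [mul_zero, Complex.exp_zero]
    ring
  refine ⟨ρ / 2, ?_, ?_⟩
  · push_cast at key
    rw [norm_div, Complex.norm_ofNat]
    linarith
  · rw [hθ, show ∑' m, normTerm₁₁ z₁ z₂ z₃ m = ρ + (2 + 2 * cexp (Real.pi * I * z₃)) by
      rw [← hsum, hρ]; ring]
    ring

/-! ### Arguments of the theta constants -/

/-- The open sector of complex numbers with argument in `(-π/4, π/4)`. -/
def InSector (z : ℂ) : Prop := |z.im| < z.re

theorem InSector.re_mul_conj_pos {z w : ℂ} (hz : InSector z) (hw : InSector w) :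
    0 < (z * conj w).re := by
  obtain ⟨h1, h2⟩ := abs_lt.1 hz
  obtain ⟨h3, h4⟩ := abs_lt.1 hw
  simp only [Complex.mul_re, Complex.conj_re, Complex.conj_im]
  nlinarith [mul_pos (sub_pos.2 h2) (sub_pos.2 h4), mul_pos (sub_pos.2 h1) (sub_pos.2 h3)]

theorem re_mul_conj_comm (z w : ℂ) : (z * conj w).re = (w * conj z).re := by
  simp only [Complex.mul_re, Complex.conj_re, Complex.conj_im]
  ring

theorem inSector_of_norm_sub_one_le {z : ℂ} (h : ‖z - 1‖ ≤ 41 / 100) : InSector z := by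
  have h1 := (Complex.abs_im_le_norm (z - 1)).trans h
  have h2 := (abs_le.1 ((Complex.abs_re_le_norm (z - 1)).trans h)).1
  simp only [Complex.sub_im, Complex.sub_re, Complex.one_im, Complex.one_re, sub_zero] at h1 h2
  unfold InSector
  linarith

theorem lt_cos_of_abs_le {α : ℝ} (h : |α| ≤ 3 * Real.pi / 8) : 381 / 1000 < Real.cos α := by
  have h1 : Real.cos (3 * Real.pi / 8) ≤ Real.cos α := by
    rw [← Real.cos_abs α]
    exact Real.cos_le_cos_of_nonneg_of_le_pi (abs_nonneg _) (by linarith [Real.pi_pos]) h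
  have h2 : Real.cos (3 * Real.pi / 8) = √(2 - √2) / 2 := by
    rw [← Real.sin_pi_div_eight, ← Real.cos_pi_div_two_sub]
    congr 1; ring
  have h3 : √2 ≤ 1.4143 := by
    rw [Real.sqrt_le_left (by norm_num)]; norm_num
  have h4 : (0.765 : ℝ) ≤ √(2 - √2) := Real.le_sqrt_of_sq_le (by norm_num; linarith)
  norm_num at h4
  linarith

theorem re_exp_mul_pos {α : ℝ} {ζ : ℂ} (h : |α| ≤ 3 * Real.pi / 8) (hζ : ‖ζ‖ ≤ 38 / 100) :
    0 < (cexp (α * I) * (1 + ζ)).re := by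
  have h1 := lt_cos_of_abs_le h
  have h2 := (abs_le.1 (Complex.abs_re_le_norm (cexp (α * I) * ζ))).1
  rw [norm_mul, Complex.norm_exp_ofReal_mul_I, one_mul] at h2
  rw [mul_add, mul_one, Complex.add_re, Complex.exp_ofReal_mul_I_re]
  linarith

theorem inSector_exp_mul {α : ℝ} {ζ : ℂ} (h : |α| ≤ Real.pi / 8) (hζ : ‖ζ‖ ≤ 38 / 100) :
    InSector (cexp (α * I) * (1 + ζ)) := by
  obtain ⟨h1, h2⟩ := abs_le.1 h
  have hc : 0 < √2 / 2 := by positivity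
  -- Membership in the sector means that the real part stays positive after rotation by ±π/4; hence
  -- the angle 3π/8 = π/8 + π/4 in `re_exp_mul_pos`.
  have key : ∀ s : ℝ, s = Real.pi / 4 ∨ s = -(Real.pi / 4) →
      0 < Real.cos s * (cexp (α * I) * (1 + ζ)).re - Real.sin s * (cexp (α * I) * (1 + ζ)).im := by
    intro s hs
    have := re_exp_mul_pos (α := s + α) (ζ := ζ)
      (by rw [abs_le]; rcases hs with rfl | rfl <;> constructor <;> linarith) hζ
    rwa [Complex.ofReal_add, add_mul, Complex.exp_add, mul_assoc, Complex.mul_re,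
      Complex.exp_ofReal_mul_I_re, Complex.exp_ofReal_mul_I_im] at this
  have k1 := key _ (Or.inl rfl)
  have k2 := key _ (Or.inr rfl)
  rw [Real.cos_pi_div_four, Real.sin_pi_div_four, ← mul_sub] at k1
  rw [Real.cos_neg, Real.sin_neg, Real.cos_pi_div_four, Real.sin_pi_div_four, neg_mul,
    sub_neg_eq_add, ← mul_add] at k2
  rw [InSector, abs_lt]
  constructor
  · linarith [(pos_iff_pos_of_mul_pos k2).1 hc]
  · linarith [(pos_iff_pos_of_mul_pos k1).1 hc]

theorem InSector.ofReal_mul {z : ℂ} (h : InSector z) {c : ℝ} (hc : 0 < c) : InSector (c * z) := by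
  unfold InSector at *
  rw [Complex.re_ofReal_mul, Complex.im_ofReal_mul, abs_mul, abs_of_pos hc]
  exact mul_lt_mul_of_pos_left h hc

theorem cexp_pi_mul_I_eq (z : ℂ) :
    cexp (Real.pi * I * z) = (Real.exp (-Real.pi * z.im) : ℝ) *
      cexp ((Real.pi * z.re : ℝ) * I) := by
  rw [Complex.ofReal_exp, ← Complex.exp_add]
  congr 1
  apply Complex.ext <;> simp

theorem inSector_thetaCoord₀₀ {y : ℝ} {z₁ z₂ z₃ : ℂ} (h : IsReduced y z₁ z₂ z₃) (b₁ b₂ : ℤ) :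
    InSector (thetaCoord 0 0 b₁ b₂ z₁ z₂ z₃) :=
  inSector_of_norm_sub_one_le (norm_thetaCoord₀₀_sub_one_le h b₁ b₂)

theorem inSector_thetaCoord₁₀ {y : ℝ} {z₁ z₂ z₃ : ℂ} (h : IsReduced y z₁ z₂ z₃)
    (hx : |z₁.re| ≤ 1 / 2) (b₂ : ℤ) : InSector (thetaCoord 1 0 0 b₂ z₁ z₂ z₃) := by
  obtain ⟨η, hη, he⟩ := exists_thetaCoord₁₀_eq h b₂
  rw [he, cexp_pi_mul_I_eq]
  have : InSector (cexp ((Real.pi * (z₁ / 4).re : ℝ) * I) * (1 + η)) := by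
    refine inSector_exp_mul ?_ (hη.trans (by norm_num))
    rw [abs_mul, abs_of_pos Real.pi_pos, show (z₁ / 4).re = z₁.re / 4 by simp, abs_div,
      abs_of_pos (by norm_num : (0 : ℝ) < 4)]
    nlinarith [Real.pi_pos]
  convert this.ofReal_mul (c := 2 * Real.exp (-Real.pi * (z₁ / 4).im)) (by positivity) using 1
  push_cast
  ring

theorem inSector_thetaCoord₀₁ {y : ℝ} {z₁ z₂ z₃ : ℂ} (h : IsReduced y z₁ z₂ z₃)
    (hx : |z₂.re| ≤ 1 / 2) (b₁ : ℤ) : InSector (thetaCoord 0 1 b₁ 0 z₁ z₂ z₃) := by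
  rw [← thetaCoord_swap]
  exact inSector_thetaCoord₁₀ h.swap hx b₁

theorem re_mul_conj_ge {u w ε η : ℂ} (hu : ‖u‖ = 1) :
    u.re + (u * w).re - (1 + ‖w‖) * ‖η‖ - ‖ε‖ * (1 + ‖η‖) ≤
      (u * (1 + w + ε) * conj (1 + η)).re := by
  have e : u * (1 + w + ε) * conj (1 + η) =
      u + u * w + u * (1 + w) * conj η + u * ε * conj (1 + η) := by
    rw [map_add, map_one]; ring
  have h1 := (abs_le.1 (Complex.abs_re_le_norm (u * (1 + w) * conj η))).1
  have h2 := (abs_le.1 (Complex.abs_re_le_norm (u * ε * conj (1 + η)))).1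
  rw [norm_mul, norm_mul, hu, one_mul, Complex.norm_conj] at h1 h2
  have h3 : ‖1 + w‖ ≤ 1 + ‖w‖ := by simpa using norm_add_le (1 : ℂ) w
  have h4 : ‖1 + η‖ ≤ 1 + ‖η‖ := by simpa using norm_add_le (1 : ℂ) η
  have h5 := mul_le_mul_of_nonneg_right h3 (norm_nonneg η)
  have h6 := mul_le_mul_of_nonneg_left h4 (norm_nonneg ε)
  rw [e, Complex.add_re, Complex.add_re, Complex.add_re]
  linarith

theorem re_exp_mul_conj_exp (α β c : ℝ) :
    (cexp (α * I) * conj ((c : ℂ) * cexp (β * I))).re = c * Real.cos (α - β) := by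
  rw [map_mul, Complex.conj_ofReal, Complex.mul_re, Complex.re_ofReal_mul, Complex.im_ofReal_mul,
    Complex.conj_re, Complex.conj_im, Complex.exp_ofReal_mul_I_re, Complex.exp_ofReal_mul_I_im,
    Complex.exp_ofReal_mul_I_re, Complex.exp_ofReal_mul_I_im, Real.cos_sub]
  ring

theorem re_exp_mul_exp (α β c : ℝ) :
    (cexp (α * I) * ((c : ℂ) * cexp (β * I))).re = c * Real.cos (α + β) := by
  rw [Complex.mul_re, Complex.re_ofReal_mul, Complex.im_ofReal_mul,
    Complex.exp_ofReal_mul_I_re, Complex.exp_ofReal_mul_I_im,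
    Complex.exp_ofReal_mul_I_re, Complex.exp_ofReal_mul_I_im, Real.cos_add]
  ring

theorem re_theta₁₁_mul_conj_theta₁₀_pos {y : ℝ} {z₁ z₂ z₃ : ℂ} (h : IsReduced y z₁ z₂ z₃)
    (hx₂ : |z₂.re| ≤ 1 / 2) (hx₃ : |z₃.re| ≤ 1 / 2) :
    0 < (thetaCoord 1 1 0 0 z₁ z₂ z₃ * conj (thetaCoord 1 0 0 0 z₁ z₂ z₃)).re := by
  obtain ⟨ε, hε, he₁₁⟩ := exists_thetaCoord₁₁_eq h
  obtain ⟨η, hη, he₁₀⟩ := exists_thetaCoord₁₀_eq h 0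
  have hπ := Real.pi_pos
  have hp3 : nome y ^ 3 ≤ (257 / 1000) ^ 3 := pow_le_pow_left₀ (nome_pos y).le (nome_le h.le) 3
  obtain ⟨h21, h22⟩ := abs_le.1 hx₂
  obtain ⟨h31, h32⟩ := abs_le.1 hx₃
  -- The contributions of x₁ cancel. Both β and β + π·x₃ = π(x₂ + 2x₃)/4 are at most 3π/8 in
  -- absolute value.
  set β : ℝ := Real.pi * ((z₂.re - 2 * z₃.re) / 4) with hβ
  set c : ℝ := 4 * Real.exp (-Real.pi * ((z₁ + z₂ - 2 * z₃) / 4).im) *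
    Real.exp (-Real.pi * (z₁ / 4).im) with hc
  have hc0 : 0 < c := by positivity
  have e : thetaCoord 1 1 0 0 z₁ z₂ z₃ * conj (thetaCoord 1 0 0 0 z₁ z₂ z₃) =
      c * (cexp (β * I) * (1 + cexp (Real.pi * I * z₃) + ε) * conj (1 + η)) := by
    have hb : (β : ℂ) * I = (Real.pi * ((z₁ + z₂ - 2 * z₃) / 4).re : ℝ) * I +
        conj ((Real.pi * (z₁ / 4).re : ℝ) * I) := by
      rw [map_mul, Complex.conj_ofReal, Complex.conj_I, mul_neg, ← sub_eq_add_neg, ← sub_mul,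
        ← Complex.ofReal_sub]
      congr 2
      simp [hβ]
      ring
    rw [he₁₁, he₁₀, cexp_pi_mul_I_eq ((z₁ + z₂ - 2 * z₃) / 4), cexp_pi_mul_I_eq (z₁ / 4), hb,
      Complex.exp_add, Complex.exp_conj, hc]
    simp only [map_mul, Complex.conj_ofReal, map_ofNat]
    push_cast
    ring
  rw [e, Complex.re_ofReal_mul]
  refine mul_pos hc0 (lt_of_lt_of_le ?_ (re_mul_conj_ge (Complex.norm_exp_ofReal_mul_I β)))
  have hw : ‖cexp (Real.pi * I * z₃)‖ = Real.exp (-Real.pi * z₃.im) := norm_cexp_pi_mul_I _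
  rw [hw, Complex.exp_ofReal_mul_I_re, cexp_pi_mul_I_eq, re_exp_mul_exp]
  have h1 : 381 / 1000 < Real.cos β := lt_cos_of_abs_le (by
    rw [abs_le, hβ]; constructor <;> nlinarith)
  have h2 : 381 / 1000 < Real.cos (β + Real.pi * z₃.re) := lt_cos_of_abs_le (by
    rw [abs_le, hβ]; constructor <;> nlinarith)
  have hr := Real.exp_pos (-Real.pi * z₃.im)
  have h3 := mul_lt_mul_of_pos_left h2 hr
  have h4 : ‖ε‖ * (1 + ‖η‖) ≤ 5 / 100 * (13 / 10) :=
    mul_le_mul (by norm_num at hp3; linarith) (by linarith) (by positivity) (by norm_num)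
  have h5 := mul_le_mul_of_nonneg_left hη (by positivity : 0 ≤ 1 + Real.exp (-Real.pi * z₃.im))
  linarith

theorem re_theta₁₁_mul_conj_theta₀₁_pos {y : ℝ} {z₁ z₂ z₃ : ℂ} (h : IsReduced y z₁ z₂ z₃)
    (hx₁ : |z₁.re| ≤ 1 / 2) (hx₃ : |z₃.re| ≤ 1 / 2) :
    0 < (thetaCoord 1 1 0 0 z₁ z₂ z₃ * conj (thetaCoord 0 1 0 0 z₁ z₂ z₃)).re := by
  rw [← thetaCoord_swap, ← thetaCoord_swap 0 1]
  exact re_theta₁₁_mul_conj_theta₁₀_pos h.swap hx₁ hx₃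

theorem abs_pi_mul_le {t c : ℝ} (h : |t| ≤ c) : |Real.pi * t| ≤ Real.pi * c := by
  rw [abs_mul, abs_of_pos Real.pi_pos]
  exact mul_le_mul_of_nonneg_left h Real.pi_pos.le

theorem cos_pi_mul_le_of_abs_le {t c : ℝ} (h : |t| ≤ c) (hc : c ≤ 1) :
    Real.cos (Real.pi * c) ≤ Real.cos (Real.pi * t) := by
  rw [← Real.cos_abs (Real.pi * t)]
  exact Real.cos_le_cos_of_nonneg_of_le_pi (abs_nonneg _)
    (by nlinarith [Real.pi_pos]) (abs_pi_mul_le h)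

theorem cos_pi_mul_nonneg_of_abs_le {t : ℝ} (h : |t| ≤ 1 / 2) : 0 ≤ Real.cos (Real.pi * t) := by
  have := cos_pi_mul_le_of_abs_le h (by norm_num)
  rwa [show Real.pi * (1 / 2) = Real.pi / 2 by ring, Real.cos_pi_div_two] at this

theorem one_le_cos_add_cos {s t : ℝ} (h₁ : |s + t| ≤ 1 / 2) (h₂ : |s - t| ≤ 1 / 2) :
    1 ≤ Real.cos (Real.pi * s) + Real.cos (Real.pi * t) := by
  have hquarter : ∀ t : ℝ, |t| ≤ 1 / 4 → √2 / 2 ≤ Real.cos (Real.pi * t) := by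
    intro t ht
    have := cos_pi_mul_le_of_abs_le ht (by norm_num)
    rwa [show Real.pi * (1 / 4) = Real.pi / 4 by ring, Real.cos_pi_div_four] at this
  rw [Real.cos_add_cos, show (Real.pi * s + Real.pi * t) / 2 = Real.pi * ((s + t) / 2) by ring,
    show (Real.pi * s - Real.pi * t) / 2 = Real.pi * ((s - t) / 2) by ring]
  have h1 := hquarter ((s + t) / 2) (by rw [abs_le] at *; constructor <;> linarith)
  have h2 := hquarter ((s - t) / 2) (by rw [abs_le] at *; constructor <;> linarith)
  have h3 := mul_le_mul h1 h2 (by positivity) ((by positivity : 0 ≤ √2 / 2).trans h1)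
  have h4 : √2 * √2 = 2 := Real.mul_self_sqrt (by norm_num)
  linarith

/-- The assumption forces |x₁ + x₂ - 2x₃| > 4/3, close to its maximum 2, so (x₁, x₂, x₃) is near one
of two opposite corners of the cube. -/
theorem cos_estimates_of_cos_lt {x₁ x₂ x₃ : ℝ} (hx₁ : |x₁| ≤ 1 / 2) (hx₂ : |x₂| ≤ 1 / 2)
    (hx₃ : |x₃| ≤ 1 / 2) (h : Real.cos (Real.pi * ((x₁ + x₂ - 2 * x₃) / 4)) < 1 / 2) :
    0 ≤ Real.cos (Real.pi * ((x₁ + x₂ - 2 * x₃) / 4) - Real.pi * x₁) ∧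
    0 ≤ Real.cos (Real.pi * ((x₁ + x₂ - 2 * x₃) / 4) - Real.pi * x₂) ∧
    86 / 100 ≤ Real.cos (Real.pi * ((x₁ + x₂ - 2 * x₃) / 4) + Real.pi * x₃) := by
  have hlarge : 1 / 3 < |(x₁ + x₂ - 2 * x₃) / 4| := by
    by_contra! hle
    have := cos_pi_mul_le_of_abs_le hle (by norm_num)
    rw [show Real.pi * (1 / 3) = Real.pi / 3 by ring, Real.cos_pi_div_three] at this
    linarith
  rw [abs_le] at hx₁ hx₂ hx₃
  rw [lt_abs] at hlarge
  rw [← mul_sub, ← mul_sub, ← mul_add]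
  refine ⟨cos_pi_mul_nonneg_of_abs_le ?_, cos_pi_mul_nonneg_of_abs_le ?_, ?_⟩
  · rw [abs_le]; constructor <;> rcases hlarge with h' | h' <;> linarith
  · rw [abs_le]; constructor <;> rcases hlarge with h' | h' <;> linarith
  · have := cos_pi_mul_le_of_abs_le (t := (x₁ + x₂ - 2 * x₃) / 4 + x₃) (c := 1 / 6)
      (by rw [abs_le]; constructor <;> rcases hlarge with h' | h' <;> linarith) (by norm_num)
    rw [show Real.pi * (1 / 6) = Real.pi / 6 by ring, Real.cos_pi_div_six] at this
    have h3 : (1.73 : ℝ) ≤ √3 := Real.le_sqrt_of_sq_le (by norm_num)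
    norm_num at h3
    linarith

/-- The phase φ can reach ±π/2, where the term cos φ gives nothing. If cos φ ≥ 1/2, the crude bound
on θ₀₀ - 1 suffices. Otherwise the summand r·cos ψ coming from exp(πi·z₃) must absorb all errors. -/
theorem re_theta₁₁_mul_conj_theta₀₀_pos {y : ℝ} {z₁ z₂ z₃ : ℂ} (h : IsReduced y z₁ z₂ z₃)
    (hx₁ : |z₁.re| ≤ 1 / 2) (hx₂ : |z₂.re| ≤ 1 / 2) (hx₃ : |z₃.re| ≤ 1 / 2) :
    0 < (thetaCoord 1 1 0 0 z₁ z₂ z₃ * conj (thetaCoord 0 0 0 0 z₁ z₂ z₃)).re := by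
  obtain ⟨ε, hε, he₁₁⟩ := exists_thetaCoord₁₁_eq h
  obtain ⟨ρ, hρ, he₀₀⟩ := exists_thetaCoord₀₀_eq h
  have hη := norm_thetaCoord₀₀_sub_one_le h 0 0
  have hπ := Real.pi_pos
  have hp := nome_pos y
  have hp' := nome_le h.le
  have hp3 : nome y ^ 3 ≤ (257 / 1000) ^ 3 := pow_le_pow_left₀ hp.le hp' 3
  obtain ⟨h11, h12⟩ := abs_le.1 hx₁
  obtain ⟨h21, h22⟩ := abs_le.1 hx₂
  obtain ⟨h31, h32⟩ := abs_le.1 hx₃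
  set φ : ℝ := Real.pi * ((z₁.re + z₂.re - 2 * z₃.re) / 4) with hφ
  set ψ : ℝ := φ + Real.pi * z₃.re with hψ
  set c : ℝ := 2 * Real.exp (-Real.pi * ((z₁ + z₂ - 2 * z₃) / 4).im) with hc
  have hc0 : 0 < c := by positivity
  set w := cexp (Real.pi * I * z₃) with hwdef
  set r := Real.exp (-Real.pi * z₃.im) with hr
  have hr0 : 0 < r := Real.exp_pos _
  have hr1 : r ≤ 1 := exp_neg_pi_im_le_one h
  have hpr : nome y ≤ r := nome_le_exp_neg_pi_im h
  have hw : ‖w‖ = r := norm_cexp_pi_mul_I _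
  obtain ⟨η, hηdef⟩ : ∃ η, η = thetaCoord 0 0 0 0 z₁ z₂ z₃ - 1 := ⟨_, rfl⟩
  rw [← hηdef] at hη
  have hθ : thetaCoord 0 0 0 0 z₁ z₂ z₃ = 1 + η := by rw [hηdef]; ring
  have e : thetaCoord 1 1 0 0 z₁ z₂ z₃ * conj (thetaCoord 0 0 0 0 z₁ z₂ z₃) =
      c * (cexp (φ * I) * (1 + w + ε) * conj (1 + η)) := by
    have hb : (φ : ℂ) * I = (Real.pi * ((z₁ + z₂ - 2 * z₃) / 4).re : ℝ) * I := by
      congr 2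
      simp [hφ]
    rw [he₁₁, hθ, cexp_pi_mul_I_eq ((z₁ + z₂ - 2 * z₃) / 4), hb, hc]
    push_cast
    ring
  rw [e, Complex.re_ofReal_mul]
  refine mul_pos hc0 ?_
  have huw : (cexp (φ * I) * w).re = r * Real.cos ψ := by
    rw [hwdef, cexp_pi_mul_I_eq, re_exp_mul_exp]
  have hε' : ‖ε‖ * (1 + ‖η‖) ≤ nome y ^ 3 * (285 / 100) * (141 / 100) :=
    mul_le_mul hε (by linarith) (by positivity) (by positivity)
  by_cases hcos : 1 / 2 ≤ Real.cos φ
  · refine lt_of_lt_of_le ?_ (re_mul_conj_ge (Complex.norm_exp_ofReal_mul_I φ))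
    rw [huw, hw, Complex.exp_ofReal_mul_I_re]
    have hsum : 1 ≤ Real.cos φ + Real.cos ψ := by
      rw [hψ, hφ, ← mul_add]
      refine one_le_cos_add_cos ?_ ?_ <;> rw [abs_le] <;> constructor <;> linarith
    have h5 : (1 + r) / 2 ≤ Real.cos φ + r * Real.cos ψ := by
      nlinarith [mul_nonneg (sub_nonneg.2 hr1) (sub_nonneg.2 hcos),
        mul_nonneg hr0.le (sub_nonneg.2 hsum)]
    have h6 := mul_le_mul_of_nonneg_left hη (by positivity : 0 ≤ 1 + r)
    norm_num at hp3
    linarith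
  · have hcosφ : 0 ≤ Real.cos φ := by
      refine cos_pi_mul_nonneg_of_abs_le ?_
      rw [abs_le]; constructor <;> linarith
    obtain ⟨hcos₁, hcos₂, hcosψ⟩ := cos_estimates_of_cos_lt hx₁ hx₂ hx₃ (not_le.1 hcos)
    rw [← hφ] at hcos₁ hcos₂ hcosψ
    rw [← hψ] at hcosψ
    set q₃ := Real.exp (-Real.pi * (z₁ + z₂ - 2 * z₃).im) with hq₃
    have hq₃le : q₃ ≤ (257 / 1000) ^ 2 := by
      refine le_trans ?_ (pow_le_pow_left₀ hp.le hp' 2)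
      rw [nome_sq, hq₃, Real.exp_le_exp]
      have : (z₁ + z₂ - 2 * z₃).im = z₁.im + z₂.im - 2 * z₃.im := by simp
      rw [this]
      nlinarith [h.le₁, h.le₂, h.two_mul_le]
    have hq₃pos : 0 < q₃ := Real.exp_pos _
    -- The phase of the third exponential is 4φ, so cos(3φ) appears, and cos φ + 2q₃·cos(3φ) = cos
    -- φ·(1 - 6q₃ + 8q₃·cos²φ).
    have h3φ : 0 ≤ Real.cos φ + 2 * (q₃ * Real.cos (φ - Real.pi * (z₁ + z₂ - 2 * z₃).re)) := by
      have : φ - Real.pi * (z₁ + z₂ - 2 * z₃).re = -(3 * φ) := by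
        simp [hφ]; ring
      rw [this, Real.cos_neg, Real.cos_three_mul]
      have h1 : 0 ≤ 1 - 6 * q₃ := by norm_num at hq₃le; linarith
      nlinarith [mul_nonneg hcosφ h1, mul_nonneg hq₃pos.le (pow_nonneg hcosφ 3)]
    have hηeq : η = 2 * cexp (Real.pi * I * z₁) + 2 * cexp (Real.pi * I * z₂)
        + 2 * cexp (Real.pi * I * (z₁ + z₂ - 2 * z₃)) + ρ := by rw [hηdef, he₀₀]; ring
    set u := cexp (φ * I) with hu
    have hu1 : ‖u‖ = 1 := Complex.norm_exp_ofReal_mul_I φ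
    have eu : u * (1 + w + ε) * conj (1 + η) = u + 2 * (u * conj (cexp (Real.pi * I * z₁))) +
        2 * (u * conj (cexp (Real.pi * I * z₂))) +
        2 * (u * conj (cexp (Real.pi * I * (z₁ + z₂ - 2 * z₃)))) + u * conj ρ +
        u * w + u * w * conj η + u * ε * conj (1 + η) := by
      have : conj η = 2 * conj (cexp (Real.pi * I * z₁)) + 2 * conj (cexp (Real.pi * I * z₂))
        + 2 * conj (cexp (Real.pi * I * (z₁ + z₂ - 2 * z₃))) + conj ρ := by
        rw [hηeq]; simp only [map_add, map_mul, map_ofNat]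
      rw [map_add, map_one]
      linear_combination u * this
    have two_re : ∀ z : ℂ, (2 * z).re = 2 * z.re := fun z => by simp
    rw [eu]
    simp only [Complex.add_re, two_re]
    rw [huw, cexp_pi_mul_I_eq z₁, cexp_pi_mul_I_eq z₂, cexp_pi_mul_I_eq (z₁ + z₂ - 2 * z₃), hu,
      re_exp_mul_conj_exp, re_exp_mul_conj_exp, re_exp_mul_conj_exp, ← hu, ← hq₃, hu,
      Complex.exp_ofReal_mul_I_re, ← hu]
    have t1 := mul_nonneg (Real.exp_pos (-Real.pi * z₁.im)).le hcos₁
    have t2 := mul_nonneg (Real.exp_pos (-Real.pi * z₂.im)).le hcos₂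
    have t3 := (abs_le.1 (Complex.abs_re_le_norm (u * conj ρ))).1
    have t4 := (abs_le.1 (Complex.abs_re_le_norm (u * w * conj η))).1
    have t5 := (abs_le.1 (Complex.abs_re_le_norm (u * ε * conj (1 + η)))).1
    rw [norm_mul, hu1, one_mul, Complex.norm_conj] at t3
    rw [norm_mul, norm_mul, hu1, one_mul, Complex.norm_conj] at t4 t5
    rw [hw] at t4
    have t6 : ‖1 + η‖ ≤ 1 + ‖η‖ := by simpa using norm_add_le (1 : ℂ) η
    have t7 := mul_le_mul_of_nonneg_left t6 (norm_nonneg ε)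
    have t8 := mul_le_mul_of_nonneg_left hη hr0.le
    have t9 := mul_le_mul_of_nonneg_left hcosψ hr0.le
    have hp2 : nome y ^ 2 ≤ (257 / 1000) ^ 2 := pow_le_pow_left₀ hp.le hp' 2
    -- The main term is only 0.86·r, so the errors must also be proportional to r; this uses p ≤ r.
    -- They add up to less than 0.41·r + 0.05·r + 0.27·r.
    have t10 : nome y ^ 3 ≤ (257 / 1000) ^ 2 * r := by
      rw [pow_succ]; exact mul_le_mul hp2 hpr hp.le (by norm_num)
    have t11 : nome y ^ 4 ≤ (257 / 1000) ^ 3 * r := by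
      rw [pow_succ]; exact mul_le_mul hp3 hpr hp.le (by norm_num)
    norm_num at t10 t11
    linarith

/-! ### Good position and its propagation -/

/-- Any two members of the family enclose an angle less than `π/2`. -/
def PairwiseAcute {ι : Type*} (s : ι → ℂ) : Prop := ∀ i j, 0 < (s i * conj (s j)).re

theorem PairwiseAcute.const_mul {ι : Type*} {s : ι → ℂ} (h : PairwiseAcute s) {c : ℂ}
    (hc : c ≠ 0) : PairwiseAcute fun i => c * s i := by
  intro i j
  have : c * s i * conj (c * s j) = (normSq c : ℂ) * (s i * conj (s j)) := by
    rw [map_mul, ← Complex.mul_conj]; ring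
  simp only [this, Complex.re_ofReal_mul]
  exact mul_pos (normSq_pos.2 hc) (h i j)

theorem PairwiseAcute.inGoodPosition {ι : Type*} [Finite ι] [Nonempty ι] {s : ι → ℂ}
    (h : PairwiseAcute s) : InGoodPosition (Set.range s) := by
  obtain ⟨i₀⟩ := ‹Nonempty ι›
  -- The slope relative to s i₀ orders the arguments, so s k has the least one and all others lie at
  -- angles in [0, π/2) from it.
  obtain ⟨k, hk⟩ := Finite.exists_min fun i => (s i * conj (s i₀)).im / (s i * conj (s i₀)).re
  have him : ∀ i, 0 ≤ (s i * conj (s k)).im := by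
    intro i
    have h1 := hk i
    rw [div_le_div_iff₀ (h k i₀) (h i i₀)] at h1
    have h2 : (s i * conj (s i₀)).im * (s k * conj (s i₀)).re -
        (s k * conj (s i₀)).im * (s i * conj (s i₀)).re =
        (s i * conj (s k)).im * (s i₀ * conj (s i₀)).re := by
      simp only [Complex.mul_re, Complex.mul_im, Complex.conj_re, Complex.conj_im]
      ring
    exact nonneg_of_mul_nonneg_left (by linarith) (h i₀ i₀)
  -- A small rotation by 1 + δi makes the imaginary parts positive; by finiteness one δ keeps all
  -- real parts positive.
  have hev : ∀ᶠ δ : ℝ in nhdsWithin 0 (Set.Ioi 0),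
      ∀ i, 0 < (s i * conj (s k)).re - δ * (s i * conj (s k)).im := by
    refine Filter.Eventually.filter_mono nhdsWithin_le_nhds ?_
    rw [Filter.eventually_all]
    intro i
    have hc : ContinuousAt (fun δ : ℝ => (s i * conj (s k)).re - δ * (s i * conj (s k)).im) 0 := by
      fun_prop
    exact hc.eventually_const_lt (by simpa using h i k)
  obtain ⟨δ, hδ, hpos⟩ := (hev.and self_mem_nhdsWithin).exists
  replace hpos : 0 < δ := hpos
  refine ⟨conj (s k) * (1 + δ * I), mul_ne_zero ?_ ?_, ?_⟩
  · intro h0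
    have := h k k
    rw [h0] at this
    simp at this
  · intro h0
    have := congrArg Complex.re h0
    simp at this
  · rintro _ ⟨i, rfl⟩
    have e : conj (s k) * (1 + δ * I) * s i = (1 + δ * I) * (s i * conj (s k)) := by ring
    rw [e]
    have h1 := hδ i
    have h2 := mul_pos hpos (h i k)
    constructor
    · rw [Complex.mul_re]
      simp only [Complex.add_re, Complex.add_im, Complex.one_re, Complex.one_im,
        Complex.re_ofReal_mul, Complex.im_ofReal_mul, Complex.I_re, Complex.I_im]
      linarith
    · rw [Complex.mul_im]
      simp only [Complex.add_re, Complex.add_im, Complex.one_re, Complex.one_im,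
        Complex.re_ofReal_mul, Complex.im_ofReal_mul, Complex.I_re, Complex.I_im]
      linarith [him i]

/-- If `t` is in good position and the squares of `s` are the numbers obtained from `t` by a
Borchardt step, then no two members of `s` are orthogonal. -/
theorem re_mul_conj_ne_zero_of_borchardt {t s : (Fin 2 → ZMod 2) → ℂ}
    (ht : InGoodPosition (Set.range t))
    (hs : ∀ b, s b ^ 2 =
      1 / 4 * ∑ p : (Fin 2 → ZMod 2) × (Fin 2 → ZMod 2) with p.1 + p.2 = b, t p.1 * t p.2)
    (b c : Fin 2 → ZMod 2) : (s b * conj (s c)).re ≠ 0 := by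
  obtain ⟨u, -, hut⟩ := ht
  -- A product of two numbers in the open first quadrant has positive imaginary part. So Re(u·s_b)
  -- and Im(u·s_b) have the same sign, which orthogonality of two members would contradict.
  have him : ∀ b, 0 < ((u * s b) ^ 2).im := by
    intro b
    have e : (u * s b) ^ 2 = ((1 / 4 : ℝ) : ℂ) *
        ∑ p : (Fin 2 → ZMod 2) × (Fin 2 → ZMod 2) with p.1 + p.2 = b,
          (u * t p.1) * (u * t p.2) := by
      rw [mul_pow, hs, Finset.mul_sum, Finset.mul_sum, Finset.mul_sum]
      refine Finset.sum_congr rfl fun p _ => ?_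
      push_cast
      ring
    rw [e, Complex.im_ofReal_mul, Complex.im_sum]
    refine mul_pos (by norm_num) (Finset.sum_pos (fun p _ => ?_) ⟨(b, 0), by simp⟩)
    obtain ⟨h1, h2⟩ := hut _ ⟨p.1, rfl⟩
    obtain ⟨h3, h4⟩ := hut _ ⟨p.2, rfl⟩
    rw [Complex.mul_im]
    positivity
  intro h0
  have h1 := him b
  have h2 := him c
  have h3 : ((u * s b) * conj (u * s c)).re = 0 := by
    have : u * s b * conj (u * s c) = (normSq u : ℂ) * (s b * conj (s c)) := by
      rw [map_mul, ← Complex.mul_conj]; ring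
    rw [this, Complex.re_ofReal_mul, h0, mul_zero]
  rw [pow_two, Complex.mul_im] at h1 h2
  rw [Complex.mul_re, Complex.conj_re, Complex.conj_im] at h3
  have h4 : (u * s b).re * (u * s c).re = -((u * s b).im * (u * s c).im) := by linarith
  have h5 : 0 < ((u * s b).re * (u * s b).im) * ((u * s c).re * (u * s c).im) :=
    mul_pos (by linarith) (by linarith)
  have h6 : ((u * s b).re * (u * s b).im) * ((u * s c).re * (u * s c).im) =
      -((u * s b).im * (u * s c).im) ^ 2 := by
    linear_combination ((u * s b).im * (u * s c).im) * h4
  linarith [sq_nonneg ((u * s b).im * (u * s c).im)]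

/-! ### The action of γ_k in coordinates -/

/-- The symmetric matrix with given coordinates. -/
def toMat (z : ℂ × ℂ × ℂ) : Matrix (Fin 2) (Fin 2) ℂ := !![z.1, z.2.2; z.2.2, z.2.1]

theorem theta_toMat (b : Fin 2 → ZMod 2) (z : ℂ × ℂ × ℂ) :
    theta 0 b (toMat z) = thetaCoord 0 0 (b 0).val (b 1).val z.1 z.2.1 z.2.2 := by
  rw [theta_eq_thetaCoord 0 b (by simp [toMat])]
  simp [toMat]

theorem smul_toMat (c : ℂ) (z : ℂ × ℂ × ℂ) : c • toMat z = toMat (c • z) := by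
  ext i j
  fin_cases i <;> fin_cases j <;> simp [toMat]

/-- The action of the matrices `gamma k` in coordinates. -/
noncomputable def actCoord : Fin 4 → ℂ × ℂ × ℂ → ℂ × ℂ × ℂ :=
  ![fun z => z,
    fun z => (-1 / z.1 - 1, z.2.1 - z.2.2 ^ 2 / z.1, -z.2.2 / z.1),
    fun z => (z.1 - z.2.2 ^ 2 / z.2.1, -1 / z.2.1 - 1, -z.2.2 / z.2.1),
    fun z => (-z.1 / (z.1 * z.2.1 - z.2.2 ^ 2), -z.2.1 / (z.1 * z.2.1 - z.2.2 ^ 2),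
      z.2.2 / (z.1 * z.2.1 - z.2.2 ^ 2) - 1)]

theorem IsSiegel.det_ne_zero {z₁ z₂ z₃ : ℂ} (h : IsSiegel z₁ z₂ z₃) : z₁ * z₂ - z₃ ^ 2 ≠ 0 := by
  have h1 := h.partialInv.swap.ne_zero
  have h2 := h.ne_zero
  intro h0
  refine h1 ?_
  field_simp
  linear_combination h0

theorem mul_inv_eq_of_eq_mul {X M N : Matrix (Fin 2) (Fin 2) ℂ} (hM : M.det ≠ 0)
    (h : N = X * M) : N * M⁻¹ = X := by
  rw [h, Matrix.mul_nonsing_inv_cancel_right _ _ (Ne.isUnit hM)]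

theorem blockA_gammaOf (S : Matrix (Fin 2) (Fin 2) ℤ) (hS : Sᵀ = S) :
    blockA (gammaOf S hS) = -1 := by
  simp only [blockA, gammaOf, toBlocks_fromBlocks₁₁]
  ext i j; fin_cases i <;> fin_cases j <;> simp

theorem blockB_gammaOf (S : Matrix (Fin 2) (Fin 2) ℤ) (hS : Sᵀ = S) :
    blockB (gammaOf S hS) = -S.map (fun x : ℤ => (x : ℂ)) := by
  simp only [blockB, gammaOf, toBlocks_fromBlocks₁₂]
  ext i j; simp

theorem blockC_gammaOf (S : Matrix (Fin 2) (Fin 2) ℤ) (hS : Sᵀ = S) :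
    blockC (gammaOf S hS) = S.map (fun x : ℤ => (x : ℂ)) := by
  simp only [blockC, gammaOf, toBlocks_fromBlocks₂₁]

theorem blockD_gammaOf (S : Matrix (Fin 2) (Fin 2) ℤ) (hS : Sᵀ = S) :
    blockD (gammaOf S hS) = (-1 + S ^ 2).map (fun x : ℤ => (x : ℂ)) := by
  simp only [blockD, gammaOf, toBlocks_fromBlocks₂₂]

theorem denom_gamma_one (z : ℂ × ℂ × ℂ) :
    blockC (gamma 1) * toMat z + blockD (gamma 1) = !![z.1, z.2.2; 0, -1] := by
  rw [gamma]
  simp only [Matrix.cons_val_one, Matrix.cons_val_zero]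
  rw [blockC_gammaOf, blockD_gammaOf]
  ext i j
  fin_cases i <;> fin_cases j <;> simp [toMat, pow_two, Matrix.mul_apply]

theorem denom_gamma_two (z : ℂ × ℂ × ℂ) :
    blockC (gamma 2) * toMat z + blockD (gamma 2) = !![-1, 0; z.2.2, z.2.1] := by
  rw [gamma]
  simp only [Matrix.cons_val]
  rw [blockC_gammaOf, blockD_gammaOf]
  ext i j
  fin_cases i <;> fin_cases j <;> simp [toMat, pow_two, Matrix.mul_apply]

theorem denom_gamma_three (z : ℂ × ℂ × ℂ) :
    blockC (gamma 3) * toMat z + blockD (gamma 3) = !![z.2.2, z.2.1; z.1, z.2.2] := by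
  rw [gamma]
  simp only [Matrix.cons_val]
  rw [blockC_gammaOf, blockD_gammaOf]
  ext i j
  fin_cases i <;> fin_cases j <;> simp [toMat, pow_two, Matrix.mul_apply]

theorem spAct_gamma (k : Fin 4) {z : ℂ × ℂ × ℂ} (h : IsSiegel z.1 z.2.1 z.2.2) :
    spAct (gamma k) (toMat z) = toMat (actCoord k z) := by
  have h1 := h.ne_zero
  have h2 := h.swap.ne_zero
  have hd := h.det_ne_zero
  fin_cases k
  · have e1 : blockA (gamma 0) = 1 := by
      ext i j; fin_cases i <;> fin_cases j <;> simp [blockA, gamma, toBlocks₁₁]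
    have e2 : blockB (gamma 0) = 0 := by
      ext i j; fin_cases i <;> fin_cases j <;> simp [blockB, gamma, toBlocks₁₂]
    have e3 : blockC (gamma 0) = 0 := by
      ext i j; fin_cases i <;> fin_cases j <;> simp [blockC, gamma, toBlocks₂₁]
    have e4 : blockD (gamma 0) = 1 := by
      ext i j; fin_cases i <;> fin_cases j <;> simp [blockD, gamma, toBlocks₂₂]
    change spAct (gamma 0) _ = _
    simp [spAct, e1, e2, e3, e4, actCoord]
  · change spAct (gamma 1) _ = _
    rw [spAct, denom_gamma_one]
    refine mul_inv_eq_of_eq_mul (by simpa [Matrix.det_fin_two] using h1) ?_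
    rw [gamma]
    simp only [Matrix.cons_val_one, Matrix.cons_val_zero]
    rw [blockA_gammaOf, blockB_gammaOf]
    ext i j
    fin_cases i <;> fin_cases j <;>
      simp [toMat, actCoord, Matrix.mul_apply] <;> field_simp <;> ring
  · change spAct (gamma 2) _ = _
    rw [spAct, denom_gamma_two]
    refine mul_inv_eq_of_eq_mul (by simpa [Matrix.det_fin_two] using h2) ?_
    rw [gamma]
    simp only [Matrix.cons_val]
    rw [blockA_gammaOf, blockB_gammaOf]
    ext i j
    fin_cases i <;> fin_cases j <;>
      simp [toMat, actCoord, Matrix.mul_apply] <;> field_simp <;> ring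
  · change spAct (gamma 3) _ = _
    rw [spAct, denom_gamma_three]
    refine mul_inv_eq_of_eq_mul ?_ ?_
    · rw [Matrix.det_fin_two]
      simp only [Matrix.of_apply, Matrix.cons_val', Matrix.cons_val_zero, Matrix.cons_val_one,
        Matrix.cons_val_fin_one]
      intro h0
      exact hd (by linear_combination -h0)
    rw [gamma]
    simp only [Matrix.cons_val]
    rw [blockA_gammaOf, blockB_gammaOf]
    ext i j
    fin_cases i <;> fin_cases j <;>
      simp [toMat, actCoord, Matrix.mul_apply] <;> field_simp <;> ring

/-! ### Connectedness of F' -/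

/-- The domain `FPrime` in coordinates. -/
def FCoord : Set (ℂ × ℂ × ℂ) :=
  {z | |z.1.re| ≤ 1 / 2 ∧ |z.2.1.re| ≤ 1 / 2 ∧ |z.2.2.re| ≤ 1 / 2 ∧
    2 * |z.2.2.im| ≤ z.1.im ∧ z.1.im ≤ z.2.1.im ∧ √3 / 2 ≤ z.1.im ∧ 1 ≤ ‖z.1‖ ∧ 1 ≤ ‖z.2.1‖}

theorem isReduced_or_of_mem_FCoord {z : ℂ × ℂ × ℂ} (h : z ∈ FCoord) :
    IsReduced z.1.im z.1 z.2.1 z.2.2 ∨ IsReduced z.1.im z.1 z.2.1 (-z.2.2) := by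
  obtain ⟨-, -, -, h1, h2, h3, -, -⟩ := h
  rcases le_total 0 z.2.2.im with h0 | h0
  · rw [abs_of_nonneg h0] at h1
    exact Or.inl ⟨h3, le_rfl, h2, h0, h1⟩
  · rw [abs_of_nonpos h0] at h1
    exact Or.inr ⟨h3, le_rfl, h2, by simpa using h0, by simpa using h1⟩

theorem isSiegel_of_mem_FCoord {z : ℂ × ℂ × ℂ} (h : z ∈ FCoord) :
    IsSiegel z.1 z.2.1 z.2.2 := by
  rcases isReduced_or_of_mem_FCoord h with h | h
  · exact h.isSiegel
  · simpa [IsSiegel] using h.isSiegel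

/-- The part of `FCoord` with `1 ≤ Im z₁`, which is convex. -/
def FCoordUpper : Set (ℂ × ℂ × ℂ) :=
  {z | |z.1.re| ≤ 1 / 2 ∧ |z.2.1.re| ≤ 1 / 2 ∧ |z.2.2.re| ≤ 1 / 2 ∧
    2 * |z.2.2.im| ≤ z.1.im ∧ z.1.im ≤ z.2.1.im ∧ 1 ≤ z.1.im}

theorem convex_FCoordUpper : Convex ℝ FCoordUpper := by
  have key : ∀ {x y a b c d : ℝ}, 0 ≤ a → 0 ≤ b → |x| ≤ c → |y| ≤ d →
      |a * x + b * y| ≤ a * c + b * d := by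
    intro x y a b c d ha hb hx hy
    refine (abs_add_le _ _).trans ?_
    rw [abs_mul, abs_mul, abs_of_nonneg ha, abs_of_nonneg hb]
    gcongr
  rintro x ⟨h1, h2, h3, h4, h5, h6⟩ y ⟨k1, k2, k3, k4, k5, k6⟩ a b ha hb hab
  have hhalf : a * (1 / 2) + b * (1 / 2) = 1 / 2 := by rw [← add_mul, hab, one_mul]
  simp only [FCoordUpper, Set.mem_ofPred_eq, Prod.fst_add, Prod.snd_add, Prod.smul_fst,
    Prod.smul_snd, Complex.add_re, Complex.add_im, Complex.real_smul, Complex.re_ofReal_mul,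
    Complex.im_ofReal_mul]
  refine ⟨hhalf ▸ key ha hb h1 k1, hhalf ▸ key ha hb h2 k2, hhalf ▸ key ha hb h3 k3, ?_, ?_, ?_⟩
  · have := key ha hb (c := x.1.im / 2) (d := y.1.im / 2) (x := x.2.2.im) (y := y.2.2.im)
      (by linarith) (by linarith)
    linarith
  · gcongr
  · have := add_le_add (mul_le_mul_of_nonneg_left h6 ha) (mul_le_mul_of_nonneg_left k6 hb)
    linarith

theorem FCoordUpper_subset : FCoordUpper ⊆ FCoord := by
  rintro z ⟨h1, h2, h3, h4, h5, h6⟩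
  have h7 : √3 / 2 ≤ 1 := by
    have : √3 ≤ 2 := by rw [Real.sqrt_le_left (by norm_num)]; norm_num
    linarith
  exact ⟨h1, h2, h3, h4, h5, h7.trans h6, h6.trans ((le_abs_self _).trans (abs_im_le_norm _)),
    (h6.trans h5).trans ((le_abs_self _).trans (abs_im_le_norm _))⟩

/-- The base point `i · 1`. -/
noncomputable def basePoint : ℂ × ℂ × ℂ := (I, I, 0)

theorem basePoint_mem : basePoint ∈ FCoordUpper := by
  simp [basePoint, FCoordUpper]

theorem one_le_norm_add_mul_I {z : ℂ} (hz : 1 ≤ ‖z‖) (hi : 0 ≤ z.im) {t : ℝ} (ht : 0 ≤ t) :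
    1 ≤ ‖z + t * I‖ := by
  refine hz.trans ?_
  rw [Complex.norm_eq_sqrt_sq_add_sq, Complex.norm_eq_sqrt_sq_add_sq]
  refine Real.sqrt_le_sqrt ?_
  simp
  nlinarith

/-- The conditions |z_j| ≥ 1 destroy convexity. Adding t·i to z₁ and z₂ stays in the domain,
however, and for t = 1 reaches the convex part Im z₁ ≥ 1. -/
theorem isPreconnected_FCoord : IsPreconnected FCoord := by
  refine isPreconnected_of_forall basePoint fun z hz => ?_
  set L : Set (ℂ × ℂ × ℂ) := (fun t : ℝ => z + ((t * I, t * I, 0) : ℂ × ℂ × ℂ)) '' Set.Icc 0 1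
  have hL : IsPreconnected L := isPreconnected_Icc.image _ (by fun_prop)
  obtain ⟨h1, h2, h3, h4, h5, h6, h7, h8⟩ := hz
  have h0 : 0 ≤ z.1.im := le_trans (by positivity) h6
  have hLF : L ⊆ FCoord := by
    rintro _ ⟨t, ⟨ht, -⟩, rfl⟩
    refine ⟨by simpa using h1, by simpa using h2, by simpa using h3, ?_, by simpa using h5, ?_,
      one_le_norm_add_mul_I h7 h0 ht, one_le_norm_add_mul_I h8 (h0.trans h5) ht⟩
    · simp only [Prod.fst_add, Prod.snd_add, add_zero, Complex.add_im, Complex.im_ofReal_mul,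
        Complex.I_im]
      linarith
    · simp only [Prod.fst_add, Complex.add_im, Complex.im_ofReal_mul, Complex.I_im]
      linarith
  have htop : z + ((I, I, 0) : ℂ × ℂ × ℂ) ∈ FCoordUpper := by
    refine ⟨by simpa using h1, by simpa using h2, by simpa using h3, ?_, by simpa using h5, ?_⟩
    · simp only [Prod.fst_add, Prod.snd_add, add_zero, Complex.add_im, Complex.I_im]
      linarith
    · simp only [Prod.fst_add, Complex.add_im, Complex.I_im]
      linarith
  refine ⟨L ∪ FCoordUpper, Set.union_subset hLF FCoordUpper_subset, Or.inr basePoint_mem,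
    Or.inl ⟨0, by simp, by simp⟩, ?_⟩
  exact hL.union _ ⟨1, by simp, by simp⟩ htop convex_FCoordUpper.isPreconnected

/-! ### Theta constants at γ_kτ -/

theorem isSiegel_sub_one {z₁ z₂ z₃ : ℂ} (h : IsSiegel z₁ z₂ z₃) : IsSiegel (z₁ - 1) z₂ z₃ := by
  simpa [IsSiegel] using h

/-- Full inversion is the composite of the partial inversions in the two variables, so no separate
transformation formula is needed for k = 3. -/
theorem inv_coord_eq {z₁ z₂ z₃ : ℂ} (h₁ : z₁ ≠ 0) (hd : z₁ * z₂ - z₃ ^ 2 ≠ 0) :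
    -z₁ / (z₁ * z₂ - z₃ ^ 2) = -1 / (z₂ - z₃ ^ 2 / z₁) ∧
    -z₂ / (z₁ * z₂ - z₃ ^ 2) = -1 / z₁ - (-z₃ / z₁) ^ 2 / (z₂ - z₃ ^ 2 / z₁) ∧
    z₃ / (z₁ * z₂ - z₃ ^ 2) = -(-z₃ / z₁) / (z₂ - z₃ ^ 2 / z₁) := by
  have e₀ : z₂ - z₃ ^ 2 / z₁ = (z₁ * z₂ - z₃ ^ 2) / z₁ := by field_simp
  rw [e₀]
  obtain ⟨d, hd'⟩ : ∃ d, d = z₁ * z₂ - z₃ ^ 2 := ⟨_, rfl⟩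
  rw [← hd'] at hd ⊢
  refine ⟨?_, ?_, ?_⟩
  · field_simp
  · field_simp
    linear_combination hd'
  · field_simp

theorem IsSiegel.inv {z₁ z₂ z₃ : ℂ} (h : IsSiegel z₁ z₂ z₃) :
    IsSiegel (-z₁ / (z₁ * z₂ - z₃ ^ 2)) (-z₂ / (z₁ * z₂ - z₃ ^ 2)) (z₃ / (z₁ * z₂ - z₃ ^ 2)) := by
  obtain ⟨e₁, e₂, e₃⟩ := inv_coord_eq h.ne_zero h.det_ne_zero
  rw [e₁, e₂, e₃]
  exact h.partialInv.swap.partialInv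

theorem isSiegel_actCoord (k : Fin 4) {z : ℂ × ℂ × ℂ} (h : IsSiegel z.1 z.2.1 z.2.2) :
    IsSiegel (actCoord k z).1 (actCoord k z).2.1 (actCoord k z).2.2 := by
  fin_cases k
  · exact h
  · exact isSiegel_sub_one h.partialInv
  · exact (isSiegel_sub_one h.swap.partialInv).swap
  · simpa [IsSiegel, actCoord] using h.inv

theorem continuousAt_actCoord (k : Fin 4) {z : ℂ × ℂ × ℂ} (h : IsSiegel z.1 z.2.1 z.2.2) :
    ContinuousAt (actCoord k) z := by
  have h1 := h.ne_zero
  have h2 := h.swap.ne_zero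
  have hd := h.det_ne_zero
  fin_cases k
  · exact continuousAt_id
  · change ContinuousAt (fun z : ℂ × ℂ × ℂ =>
      (-1 / z.1 - 1, z.2.1 - z.2.2 ^ 2 / z.1, -z.2.2 / z.1)) z
    fun_prop (disch := assumption)
  · change ContinuousAt (fun z : ℂ × ℂ × ℂ =>
      (z.1 - z.2.2 ^ 2 / z.2.1, -1 / z.2.1 - 1, -z.2.2 / z.2.1)) z
    fun_prop (disch := assumption)
  · change ContinuousAt (fun z : ℂ × ℂ × ℂ =>
      (-z.1 / (z.1 * z.2.1 - z.2.2 ^ 2), -z.2.1 / (z.1 * z.2.1 - z.2.2 ^ 2),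
        z.2.2 / (z.1 * z.2.1 - z.2.2 ^ 2) - 1)) z
    fun_prop (disch := assumption)

theorem im_pow_two_smul (n : ℕ) (w : ℂ) : ((2 : ℂ) ^ n • w).im = 2 ^ n * w.im := by
  have : (2 : ℂ) ^ n • w = ((2 ^ n : ℝ) : ℂ) * w := by simp
  rw [this, Complex.im_ofReal_mul]

theorem IsSiegel.pow_two_smul {z : ℂ × ℂ × ℂ} (h : IsSiegel z.1 z.2.1 z.2.2) (n : ℕ) :
    IsSiegel ((2 : ℂ) ^ n • z).1 ((2 : ℂ) ^ n • z).2.1 ((2 : ℂ) ^ n • z).2.2 := by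
  have h2 : (0 : ℝ) < 2 ^ n := by positivity
  simp only [IsSiegel, Prod.smul_fst, Prod.smul_snd, im_pow_two_smul]
  refine ⟨mul_pos h2 h.1, ?_⟩
  nlinarith [mul_lt_mul_of_pos_left h.2 (mul_pos h2 h2)]

theorem factor_ne_zero {z : ℂ} (hz : z ≠ 0) : 1 / (-I * (-1 / z)) ^ (1 / 2 : ℂ) ≠ 0 := by
  refine one_div_ne_zero ?_
  rw [Ne, Complex.cpow_eq_zero_iff]
  intro h
  exact mul_ne_zero (neg_ne_zero.2 I_ne_zero) (div_ne_zero (by norm_num) hz) h.1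

theorem val_cases (x : ZMod 2) : (x.val : ℤ) = 0 ∨ (x.val : ℤ) = 1 := by
  revert x; decide

theorem pairwiseAcute_of_inSector {ι : Type*} {s : ι → ℂ} (h : ∀ i, InSector (s i)) :
    PairwiseAcute s := fun i j => (h i).re_mul_conj_pos (h j)

theorem inSector_thetaCoord_of_mem {z : ℂ × ℂ × ℂ} (h : z ∈ FCoord) (b₁ b₂ : ℤ) :
    InSector (thetaCoord 0 0 b₁ b₂ z.1 z.2.1 z.2.2) ∧
    InSector (thetaCoord 1 0 0 b₂ z.1 z.2.1 z.2.2) ∧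
    InSector (thetaCoord 0 1 b₁ 0 z.1 z.2.1 z.2.2) := by
  rcases isReduced_or_of_mem_FCoord h with h' | h'
  · exact ⟨inSector_thetaCoord₀₀ h' _ _, inSector_thetaCoord₁₀ h' h.1 _,
      inSector_thetaCoord₀₁ h' h.2.1 _⟩
  · rw [← thetaCoord_neg 0 0 b₁ b₂ (by simp), ← thetaCoord_neg 1 0 0 b₂ (by simp),
      ← thetaCoord_neg 0 1 b₁ 0 (by simp)]
    exact ⟨inSector_thetaCoord₀₀ h' _ _, inSector_thetaCoord₁₀ h' h.1 _,
      inSector_thetaCoord₀₁ h' h.2.1 _⟩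

theorem re_theta₁₁_mul_conj_pos_of_mem {z : ℂ × ℂ × ℂ} (h : z ∈ FCoord) :
    0 < (thetaCoord 1 1 0 0 z.1 z.2.1 z.2.2 * conj (thetaCoord 0 0 0 0 z.1 z.2.1 z.2.2)).re ∧
    0 < (thetaCoord 1 1 0 0 z.1 z.2.1 z.2.2 * conj (thetaCoord 1 0 0 0 z.1 z.2.1 z.2.2)).re ∧
    0 < (thetaCoord 1 1 0 0 z.1 z.2.1 z.2.2 * conj (thetaCoord 0 1 0 0 z.1 z.2.1 z.2.2)).re := by
  rcases isReduced_or_of_mem_FCoord h with h' | h'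
  · exact ⟨re_theta₁₁_mul_conj_theta₀₀_pos h' h.1 h.2.1 h.2.2.1,
      re_theta₁₁_mul_conj_theta₁₀_pos h' h.2.1 h.2.2.1,
      re_theta₁₁_mul_conj_theta₀₁_pos h' h.1 h.2.2.1⟩
  · have hx : |(-z.2.2).re| ≤ 1 / 2 := by rw [Complex.neg_re, abs_neg]; exact h.2.2.1
    simp only [fun a₁ a₂ => (thetaCoord_neg a₁ a₂ 0 0 (by simp) z.1 z.2.1 z.2.2).symm]
    exact ⟨re_theta₁₁_mul_conj_theta₀₀_pos h' h.1 h.2.1 hx,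
      re_theta₁₁_mul_conj_theta₁₀_pos h' h.2.1 hx,
      re_theta₁₁_mul_conj_theta₀₁_pos h' h.1 hx⟩

theorem re_thetaCoord_mul_conj_pos_of_mem {z : ℂ × ℂ × ℂ} (h : z ∈ FCoord) {a₁ a₂ c₁ c₂ : ℤ}
    (ha₁ : a₁ = 0 ∨ a₁ = 1) (ha₂ : a₂ = 0 ∨ a₂ = 1) (hc₁ : c₁ = 0 ∨ c₁ = 1)
    (hc₂ : c₂ = 0 ∨ c₂ = 1) :
    0 < (thetaCoord a₁ a₂ 0 0 z.1 z.2.1 z.2.2 *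
      conj (thetaCoord c₁ c₂ 0 0 z.1 z.2.1 z.2.2)).re := by
  obtain ⟨s₀₀, s₁₀, s₀₁⟩ := inSector_thetaCoord_of_mem h 0 0
  obtain ⟨p₀₀, p₁₀, p₀₁⟩ := re_theta₁₁_mul_conj_pos_of_mem h
  have p₁₁ : 0 < (thetaCoord 1 1 0 0 z.1 z.2.1 z.2.2 *
      conj (thetaCoord 1 1 0 0 z.1 z.2.1 z.2.2)).re := by
    rw [Complex.mul_conj, Complex.ofReal_re, normSq_pos]
    intro h0
    rw [h0] at p₀₀
    simp at p₀₀
  rcases ha₁ with rfl | rfl <;> rcases ha₂ with rfl | rfl <;> rcases hc₁ with rfl | rfl <;>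
    rcases hc₂ with rfl | rfl <;>
    first
    | assumption
    | (rw [re_mul_conj_comm]; assumption)
    | exact InSector.re_mul_conj_pos (by assumption) (by assumption)

theorem thetaCoord_actCoord_one (b₁ b₂ : ℤ) {z : ℂ × ℂ × ℂ} (h : IsSiegel z.1 z.2.1 z.2.2) :
    thetaCoord 0 0 b₁ b₂ (actCoord 1 z).1 (actCoord 1 z).2.1 (actCoord 1 z).2.2 =
      1 / (-I * (-1 / z.1)) ^ (1 / 2 : ℂ) * thetaCoord (1 - b₁) 0 0 b₂ z.1 z.2.1 z.2.2 := by
  rw [← thetaCoord_partialInv _ _ _ h, ← thetaCoord_sub_one]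
  rfl

theorem thetaCoord_actCoord_two (b₁ b₂ : ℤ) {z : ℂ × ℂ × ℂ} (h : IsSiegel z.1 z.2.1 z.2.2) :
    thetaCoord 0 0 b₁ b₂ (actCoord 2 z).1 (actCoord 2 z).2.1 (actCoord 2 z).2.2 =
      1 / (-I * (-1 / z.2.1)) ^ (1 / 2 : ℂ) * thetaCoord 0 (1 - b₂) b₁ 0 z.1 z.2.1 z.2.2 := by
  rw [← thetaCoord_swap, ← thetaCoord_swap 0 (1 - b₂), ← thetaCoord_partialInv _ _ _ h.swap,
    ← thetaCoord_sub_one]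
  rfl

theorem thetaCoord_actCoord_three (b₁ b₂ : ℤ) {z : ℂ × ℂ × ℂ} (h : IsSiegel z.1 z.2.1 z.2.2) :
    thetaCoord 0 0 b₁ b₂ (actCoord 3 z).1 (actCoord 3 z).2.1 (actCoord 3 z).2.2 =
      1 / (-I * (-1 / (z.2.1 - z.2.2 ^ 2 / z.1))) ^ (1 / 2 : ℂ) *
        (1 / (-I * (-1 / z.1)) ^ (1 / 2 : ℂ)) * thetaCoord b₂ b₁ 0 0 z.1 z.2.1 z.2.2 := by
  obtain ⟨e₁, e₂, e₃⟩ := inv_coord_eq h.ne_zero h.det_ne_zero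
  rw [mul_assoc, ← thetaCoord_partialInv _ _ _ h, ← thetaCoord_swap 0 b₁,
    ← thetaCoord_partialInv _ _ _ h.partialInv.swap, ← e₁, ← e₂, ← e₃]
  exact thetaCoord_sub_one' _ _ _ _ _

/-- The family of theta constants with `a = 0` at the point with given coordinates. -/
noncomputable def thetaFamily (z : ℂ × ℂ × ℂ) (b : Fin 2 → ZMod 2) : ℂ := theta 0 b (toMat z)

theorem pairwiseAcute_thetaFamily_of_eq {w : ℂ × ℂ × ℂ} {c : ℂ} {f : (Fin 2 → ZMod 2) → ℂ}
    (hc : c ≠ 0) (hf : PairwiseAcute f)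
    (h : ∀ b, thetaCoord 0 0 (b 0).val (b 1).val w.1 w.2.1 w.2.2 = c * f b) :
    PairwiseAcute (thetaFamily w) := by
  have : thetaFamily w = fun b => c * f b := funext fun b => (theta_toMat b w).trans (h b)
  rw [this]
  exact hf.const_mul hc

theorem pairwiseAcute_actCoord (k : Fin 4) {z : ℂ × ℂ × ℂ} (h : z ∈ FCoord) :
    PairwiseAcute (thetaFamily (actCoord k z)) := by
  have hS := isSiegel_of_mem_FCoord h
  have hsub : ∀ x : ZMod 2, (1 - (x.val : ℤ)) = 0 ∨ (1 - (x.val : ℤ)) = 1 := by decide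
  have hk : k = 0 ∨ k = 1 ∨ k = 2 ∨ k = 3 := by revert k; decide
  rcases hk with rfl | rfl | rfl | rfl
  · refine pairwiseAcute_of_inSector fun b => ?_
    rw [thetaFamily, theta_toMat]
    exact (inSector_thetaCoord_of_mem h _ _).1
  · refine pairwiseAcute_thetaFamily_of_eq (factor_ne_zero hS.ne_zero)
      (pairwiseAcute_of_inSector fun b => ?_) fun b => thetaCoord_actCoord_one _ _ hS
    obtain ⟨s₀₀, s₁₀, -⟩ := inSector_thetaCoord_of_mem h 0 (b 1).val
    rcases hsub (b 0) with h0 | h0 <;> rw [h0] <;> assumption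
  · refine pairwiseAcute_thetaFamily_of_eq (factor_ne_zero hS.swap.ne_zero)
      (pairwiseAcute_of_inSector fun b => ?_) fun b => thetaCoord_actCoord_two _ _ hS
    obtain ⟨s₀₀, -, s₀₁⟩ := inSector_thetaCoord_of_mem h (b 0).val 0
    rcases hsub (b 1) with h0 | h0 <;> rw [h0] <;> assumption
  · exact pairwiseAcute_thetaFamily_of_eq
      (mul_ne_zero (factor_ne_zero hS.partialInv.swap.ne_zero) (factor_ne_zero hS.ne_zero))
      (fun b c => re_thetaCoord_mul_conj_pos_of_mem h (val_cases _) (val_cases _) (val_cases _)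
        (val_cases _)) fun b => thetaCoord_actCoord_three _ _ hS

/-! ### Induction over n by continuity -/

theorem im_actCoord_basePoint (k : Fin 4) : (actCoord k basePoint).1.im = 1 ∧
    (actCoord k basePoint).2.1.im = 1 ∧ (actCoord k basePoint).2.2.im = 0 := by
  fin_cases k <;> simp [actCoord, basePoint]

/-- The estimate for θ_{0,b} involves only imaginary parts, so the translations by -1 in γ_k do no
harm. -/
theorem pairwiseAcute_basePoint (k : Fin 4) (n : ℕ) :
    PairwiseAcute (thetaFamily ((2 : ℂ) ^ n • actCoord k basePoint)) := by
  obtain ⟨h1, h2, h3⟩ := im_actCoord_basePoint k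
  have hred : IsReduced (2 ^ n) ((2 : ℂ) ^ n • actCoord k basePoint).1
      ((2 : ℂ) ^ n • actCoord k basePoint).2.1 ((2 : ℂ) ^ n • actCoord k basePoint).2.2 := by
    simp only [Prod.smul_fst, Prod.smul_snd]
    refine ⟨?_, ?_, ?_, ?_, ?_⟩
    · have h7 : √3 ≤ 2 := by rw [Real.sqrt_le_left (by norm_num)]; norm_num
      have h8 : (1 : ℝ) ≤ 2 ^ n := one_le_pow₀ (by norm_num)
      linarith
    · rw [im_pow_two_smul, h1, mul_one]
    · rw [im_pow_two_smul, h2, mul_one]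
    · rw [im_pow_two_smul, h3, mul_zero]
    · rw [im_pow_two_smul, h3, mul_zero, mul_zero]; positivity
  refine pairwiseAcute_of_inSector fun b => ?_
  rw [thetaFamily, theta_toMat]
  exact inSector_thetaCoord₀₀ hred _ _

theorem continuousOn_thetaFamily (k : Fin 4) (n : ℕ) (b : Fin 2 → ZMod 2) :
    ContinuousOn (fun z => thetaFamily ((2 : ℂ) ^ n • actCoord k z) b) FCoord := by
  intro z hz
  refine ContinuousAt.continuousWithinAt ?_
  have hS := isSiegel_of_mem_FCoord hz
  simp only [thetaFamily, theta_toMat]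
  have hsmul : ContinuousAt (fun w : ℂ × ℂ × ℂ => (2 : ℂ) ^ n • w) (actCoord k z) := by fun_prop
  exact ContinuousAt.comp (f := fun z => (2 : ℂ) ^ n • actCoord k z)
    (continuousAt_thetaCoord 0 0 _ _ ((isSiegel_actCoord k hS).pow_two_smul n))
    (hsmul.comp (continuousAt_actCoord k hS))

theorem thetaFamily_succ_sq (k : Fin 4) (n : ℕ) {z : ℂ × ℂ × ℂ} (h : IsSiegel z.1 z.2.1 z.2.2)
    (b : Fin 2 → ZMod 2) :
    thetaFamily ((2 : ℂ) ^ (n + 1) • actCoord k z) b ^ 2 =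
      1 / 4 * ∑ p : (Fin 2 → ZMod 2) × (Fin 2 → ZMod 2) with p.1 + p.2 = b,
        thetaFamily ((2 : ℂ) ^ n • actCoord k z) p.1 *
          thetaFamily ((2 : ℂ) ^ n • actCoord k z) p.2 := by
  have := theta_two_smul_sq b (τ := toMat ((2 : ℂ) ^ n • actCoord k z)) (by simp [toMat])
    ((isSiegel_actCoord k h).pow_two_smul n)
  rwa [smul_toMat, smul_smul, ← pow_succ'] at this

theorem pairwiseAcute_thetaFamily (k : Fin 4) (n : ℕ) :
    ∀ z ∈ FCoord, PairwiseAcute (thetaFamily ((2 : ℂ) ^ n • actCoord k z)) := by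
  induction n with
  | zero =>
    intro z hz
    rw [pow_zero, one_smul]
    exact pairwiseAcute_actCoord k hz
  | succ n ih =>
    intro z hz b c
    set g : ℂ × ℂ × ℂ → ℝ := fun z => (thetaFamily ((2 : ℂ) ^ (n + 1) • actCoord k z) b *
      conj (thetaFamily ((2 : ℂ) ^ (n + 1) • actCoord k z) c)).re with hg
    have hcont : ContinuousOn g FCoord :=
      Complex.continuous_re.comp_continuousOn ((continuousOn_thetaFamily k (n + 1) b).mul
        (Complex.continuous_conj.comp_continuousOn (continuousOn_thetaFamily k (n + 1) c)))
    -- The squares determine each theta constant only up to sign, so the Borchardt step gives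
    -- non-vanishing; the sign comes from the base point.
    have hne : ∀ w ∈ FCoord, g w ≠ 0 := fun w hw =>
      re_mul_conj_ne_zero_of_borchardt (ih w hw).inGoodPosition
        (thetaFamily_succ_sq k n (isSiegel_of_mem_FCoord hw)) b c
    have hbase : 0 < g basePoint := pairwiseAcute_basePoint k (n + 1) b c
    by_contra hneg
    obtain ⟨w, hw, hw0⟩ := isPreconnected_FCoord.intermediate_value hz
      (FCoordUpper_subset basePoint_mem) hcont ⟨not_lt.1 hneg, hbase.le⟩
    exact hne w hw hw0

/-! ### The fundamental domain and the conclusion -/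

/-- The coordinates of a matrix. -/
def coord (τ : Matrix (Fin 2) (Fin 2) ℂ) : ℂ × ℂ × ℂ := (τ 0 0, τ 1 1, τ 0 1)

theorem toMat_coord {τ : Matrix (Fin 2) (Fin 2) ℂ} (h : τ.IsSymm) : toMat (coord τ) = τ := by
  ext i j
  fin_cases i <;> fin_cases j <;> simp [toMat, coord, h.apply 0 1]

theorem FTwo_subset_FPrime : FTwo ⊆ FPrime := by
  rintro τ ⟨hτ, h1, h2, h3, h4, h5, h6, hdet⟩
  have hm := toMat_coord hτ.1
  -- For `gamma 1` and `gamma 2` the determinant of Cτ + D is -z₁ and -z₂, respectively.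
  have hz₁ : 1 ≤ ‖τ 0 0‖ := by
    have := hdet (gamma 1)
    rw [← hm, denom_gamma_one] at this
    simpa [Matrix.det_fin_two, coord] using this
  have hz₂ : 1 ≤ ‖τ 1 1‖ := by
    have := hdet (gamma 2)
    rw [← hm, denom_gamma_two] at this
    simpa [Matrix.det_fin_two, coord] using this
  have hy : √3 / 2 ≤ (τ 0 0).im := by
    have h0 : 0 ≤ (τ 0 0).im := by linarith
    rw [Complex.norm_eq_sqrt_sq_add_sq, Real.one_le_sqrt] at hz₁
    have h7 : (τ 0 0).re ^ 2 ≤ (1 / 2) ^ 2 := sq_le_sq' (abs_le.1 h1).1 (abs_le.1 h1).2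
    have h8 : √3 ≤ 2 * (τ 0 0).im := by
      rw [Real.sqrt_le_left (by linarith)]
      nlinarith
    linarith
  exact ⟨hτ, h1, h2, h3, by rw [abs_of_nonneg (by linarith)]; exact h5, h6, hy, hz₁, hz₂⟩

theorem thetaNum_mem_range {j : ℕ} (hj : j ∈ Set.Icc 0 3) (z : ℂ × ℂ × ℂ) :
    thetaNum j (toMat z) ∈ Set.range (thetaFamily z) := by
  refine ⟨![(j : ZMod 2), ((j / 2 : ℕ) : ZMod 2)], ?_⟩
  rw [thetaFamily, thetaNum]
  have h4 : j / 4 = 0 := by have := hj.2; omega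
  have h8 : j / 8 = 0 := by have := hj.2; omega
  rw [h4, h8]
  congr 1
  ext i
  fin_cases i <;> simp

end SiegelTheta

open SiegelTheta in
theorem theorem1 :
    FTwo ⊆ FPrime ∧
    ∀ τ ∈ FPrime, ∀ k : Fin 4,
      (∀ n : ℕ, InGoodPosition
        ((fun j : ℕ => thetaNum j ((2 : ℂ) ^ n • spAct (gamma k) τ)) '' Set.Icc 0 3)) ∧
      IsGoodBorchardt (borchardtSeq (spAct (gamma k) τ)) := by
  refine ⟨FTwo_subset_FPrime, fun τ hτ k => ?_⟩
  have hz : coord τ ∈ FCoord := hτ.2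
  have hS := isSiegel_of_mem_FCoord hz
  have hact : spAct (gamma k) τ = toMat (actCoord k (coord τ)) := by
    rw [← spAct_gamma k hS, toMat_coord hτ.1.1]
  have hgood := fun n => (pairwiseAcute_thetaFamily k n _ hz).inGoodPosition
  rw [hact]
  -- The square roots are the theta constants themselves.
  refine ⟨fun n => ?_, fun n b => thetaFamily ((2 : ℂ) ^ n • actCoord k (coord τ)) b,
    fun n => ⟨fun b => ?_, fun b => ?_⟩, hgood⟩
  · obtain ⟨u, hu, h⟩ := hgood n
    refine ⟨u, hu, ?_⟩
    rintro _ ⟨j, hj, rfl⟩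
    simp only [smul_toMat]
    exact h _ (thetaNum_mem_range hj _)
  · simp only [borchardtSeq, smul_toMat, thetaFamily]
  · rw [borchardtSeq, smul_toMat]
    exact thetaFamily_succ_sq k n hS b
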